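/- Let $\Theta\subset\mathbb R^d$ be open, convex and bounded, let $\mathbb T\subset\mathbb R$ be an interval (finite or infinite), and let $\lambda(\vartheta,t)>0$, $\vartheta\in\Theta$, $t\in\mathbb T$, be measurable in $t$ with $\int_{\mathbb T}\lambda(\vartheta,t)\,dt<\infty$. Let $\vartheta_0\in\Theta$ and let $X_1,X_2,\dots$ be independent inhomogeneous Poisson processes on $\mathbb T$, all with the intensity function $\lambda(\vartheta_0,\cdot)$. Write $\ell=\ln\lambda$, let a dot denote the gradient with respect to $\vartheta$, and let $$\mathbb I(\vartheta)=\int_{\mathbb T}\dot\lambda(\vartheta,t)\,\dot\lambda(\vartheta,t)^{\top}\lambda(\vartheta,t)^{-1}\,dt$$ be the Fisher information matrix. Suppose the following. * ($\mathcal L_0$) For each $t\in\mathbb T$ the function $\ell(\cdot,t)$ has derivatives of orders $1,2,3$ on $\Theta$, which are continuous in $\vartheta$ and bounded on $\Theta\times\mathbb T$; and $\inf_{\vartheta\in\Theta}\inf_{|\mu|=1}\mu^{\top}\mathbb I(\vartheta)\mu>0$. * ($\mathcal P_0$) For each $m$ there is given an estimator $\bar\vartheta_m$, a measurable function of $(X_1,\dots,X_m)$,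 such that $\bar\vartheta_m\to\vartheta_0$ in probability as $m\to\infty$ and $\sqrt m\,(\bar\vartheta_m-\vartheta_0)$ is bounded in probability. Let $\delta\in(1/3,1/2]$, $s\in(0,1]$, $N=[n^\delta]$, $k=[sn]$, where $[\cdot]$ is the integer part, and define the second preliminary estimator and the two-step MLE by $$\bar\vartheta_{k,n}=\bar\vartheta_N+\mathbb I(\bar\vartheta_N)^{-1}\frac1k\sum_{j=N+1}^{k}\int_{\mathbb T}\dot\ell(\bar\vartheta_N,t)\,[dX_j(t)-\lambda(\bar\vartheta_N,t)\,dt],$$ $$\vartheta^{\star\star}_{k,n}=\bar\vartheta_{k,n}+\mathbb I(\bar\vartheta_N)^{-1}\frac1k\sum_{j=N+1}^{k}\int_{\mathbb T}\dot\ell(\bar\vartheta_N,t)\,[dX_j(t)-\lambda(\bar\vartheta_{k,n},t)\,dt],$$ where a correction term is replaced by $0$ if an estimate occurring in it lies outside $\Theta$. Then, as $n\to\infty$, the probability that both $\bar\vartheta_N$ and $\bar\vartheta_{k,n}$ lie in $\Theta$ tends to $1$, and $$\sqrt k\,(\vartheta^{\star\star}_{k,n}-\vartheta_0)\Longrightarrow\mathcal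 N\big(0,\mathbb I(\vartheta_0)^{-1}\big).$$ -/

import Mathlib

open MeasureTheory ProbabilityTheory Filter Topology

/-- `X` is an inhomogeneous Poisson process observed on `T ⊆ ℝ` with intensity `lam` there. A path
is recorded as a right-continuous nondecreasing counting function on the whole line, starting from
`0` at `-∞` and growing only on `T`: `X ω t` is the number of events in `T` up to time `t`. The
increments over disjoint intervals are independent, and the increment over `(t₁, t₂]` has the
Poisson law with mean `∫_{(t₁, t₂] ∩ T} lam`. -/
structure IsPoissonProcess {Ω : Type*} [MeasurableSpace Ω] (P : Measure Ω) (T : Set ℝ)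
    (lam : ℝ → ℝ) (X : Ω → StieltjesFunction ℝ) : Prop where
  measurable : ∀ t : ℝ, Measurable fun ω => X ω t
  counting : ∀ ω t, ∃ m : ℕ, X ω t = m
  start_zero : ∀ ω, Tendsto (X ω) atBot (𝓝 0)
  indep_increments : HasIndepIncrements (fun (t : ℝ) (ω : Ω) => X ω t) P
  increment_law : ∀ t₁ t₂ : ℝ, t₁ < t₂ → ∀ m : ℕ,
    P {ω | X ω t₂ - X ω t₁ = m} =
      ENNReal.ofReal ((∫ t in Set.Ioc t₁ t₂ ∩ T, lam t) ^ m / (m.factorial : ℝ) *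
        Real.exp (-∫ t in Set.Ioc t₁ t₂ ∩ T, lam t))

/-- The σ-algebra generated by the first `m` observed processes `X 0, …, X (m - 1)`. -/
abbrev observedSigma {Ω : Type*} (X : ℕ → Ω → StieltjesFunction ℝ) (m : ℕ) : MeasurableSpace Ω :=
  ⨆ j ∈ Finset.range m, ⨆ t : ℝ, MeasurableSpace.comap (fun ω => X j ω t) inferInstance

section Model

variable {d : ℕ}

/-- `lam ϑ t`, for `ϑ ∈ Θ` and `t ∈ T`, is a family of intensity functions: positive, measurable in
`t` and with finite total mass on `T`. -/
structure IsIntensityFamily (Θ : Set (EuclideanSpace ℝ (Fin d))) (T : Set ℝ)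
    (lam : EuclideanSpace ℝ (Fin d) → ℝ → ℝ) : Prop where
  pos : ∀ ϑ ∈ Θ, ∀ t ∈ T, 0 < lam ϑ t
  measurable : ∀ ϑ ∈ Θ, Measurable fun t : T => lam ϑ t
  integrable : ∀ ϑ ∈ Θ, IntegrableOn (lam ϑ) T

/-- The score `∂ log lam(ϑ, t) / ∂ϑ` (gradient with respect to `ϑ`). -/
noncomputable def score (lam : EuclideanSpace ℝ (Fin d) → ℝ → ℝ)
    (ϑ : EuclideanSpace ℝ (Fin d)) (t : ℝ) : EuclideanSpace ℝ (Fin d) :=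
  gradient (fun θ => Real.log (lam θ t)) ϑ

/-- Fisher information matrix: the integral over `T` of the gradient of `lam` in `ϑ` times its
transpose, divided by `lam`. -/
noncomputable def fisherInfo (T : Set ℝ) (lam : EuclideanSpace ℝ (Fin d) → ℝ → ℝ)
    (ϑ : EuclideanSpace ℝ (Fin d)) : Matrix (Fin d) (Fin d) ℝ :=
  Matrix.of fun l k => ∫ t in T,
    gradient (fun θ => lam θ t) ϑ l * gradient (fun θ => lam θ t) ϑ k / lam ϑ t

/-- Regularity: `log lam` has three derivatives in `ϑ ∈ Θ`, continuous in `ϑ` and bounded on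
`Θ × T`, and the Fisher information is nondegenerate uniformly on `Θ`. -/
structure IsRegularModel (Θ : Set (EuclideanSpace ℝ (Fin d))) (T : Set ℝ)
    (lam : EuclideanSpace ℝ (Fin d) → ℝ → ℝ) : Prop where
  contDiff : ∀ t ∈ T, ContDiffOn ℝ 3 (fun θ => Real.log (lam θ t)) Θ
  bounded : ∃ C : ℝ, ∀ ϑ ∈ Θ, ∀ t ∈ T, ∀ m : ℕ, 1 ≤ m → m ≤ 3 →
    ‖iteratedFDeriv ℝ m (fun θ => Real.log (lam θ t)) ϑ‖ ≤ C
  nondegenerate : ∃ c : ℝ, 0 < c ∧ ∀ ϑ ∈ Θ, ∀ u : EuclideanSpace ℝ (Fin d), ‖u‖ = 1 →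
    c ≤ u ⬝ᵥ (fisherInfo T lam ϑ).mulVec u

/-- Preliminary estimators: `ϑbar m` is a function of the first `m` observations, the sequence is
consistent for `ϑ₀`, and `√m (ϑbar m - ϑ₀)` is bounded in probability. -/
structure IsPreliminaryEstimator {Ω : Type*} [MeasurableSpace Ω] (P : Measure Ω)
    (X : ℕ → Ω → StieltjesFunction ℝ) (ϑbar : ℕ → Ω → EuclideanSpace ℝ (Fin d))
    (ϑ₀ : EuclideanSpace ℝ (Fin d)) : Prop where
  measurable : ∀ m, Measurable[observedSigma X m] (ϑbar m)
  consistent : TendstoInMeasure P ϑbar atTop fun _ => ϑ₀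
  bounded_in_prob : ∀ ε : ℝ, 0 < ε → ∃ M : ℝ, ∀ m : ℕ,
    P {ω | M < √(m : ℝ) * ‖ϑbar m ω - ϑ₀‖} ≤ ENNReal.ofReal ε

/-- `∫_T score(ϑ, t) [dx(t) - lam(ϑ', t) dt]` for one observed path `x`. -/
noncomputable def scoreIntegral (T : Set ℝ) (lam : EuclideanSpace ℝ (Fin d) → ℝ → ℝ)
    (ϑ ϑ' : EuclideanSpace ℝ (Fin d)) (x : StieltjesFunction ℝ) : EuclideanSpace ℝ (Fin d) :=
  (∫ t in T, score lam ϑ t ∂x.measure) - ∫ t in T, lam ϑ' t • score lam ϑ t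

open scoped Classical in
/-- The scoring correction
`I(ϑ)⁻¹ (1/k) ∑_{j = N+1}^k ∫_T score(ϑ, t) [dX_j(t) - lam(ϑ', t) dt]`,
where `x j` is the path of the observation number `j + 1`. The model is only defined on `Θ`, so no
correction is made if `ϑ` or `ϑ'` is outside `Θ`. -/
noncomputable def scoringCorrection (Θ : Set (EuclideanSpace ℝ (Fin d))) (T : Set ℝ)
    (lam : EuclideanSpace ℝ (Fin d) → ℝ → ℝ) (N k : ℕ) (x : ℕ → StieltjesFunction ℝ)
    (ϑ ϑ' : EuclideanSpace ℝ (Fin d)) : EuclideanSpace ℝ (Fin d) :=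
  if ϑ ∈ Θ ∧ ϑ' ∈ Θ then
    Matrix.toEuclideanCLM (𝕜 := ℝ) (fisherInfo T lam ϑ)⁻¹
      ((1 / (k : ℝ)) • ∑ j ∈ Finset.Ico N k, scoreIntegral T lam ϑ ϑ' (x j))
  else 0

/-- The second preliminary (one-step) estimate computed from the value `ϑ` of the first one. -/
noncomputable def secondPreliminary (Θ : Set (EuclideanSpace ℝ (Fin d))) (T : Set ℝ)
    (lam : EuclideanSpace ℝ (Fin d) → ℝ → ℝ) (N k : ℕ) (x : ℕ → StieltjesFunction ℝ)
    (ϑ : EuclideanSpace ℝ (Fin d)) : EuclideanSpace ℝ (Fin d) :=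
  ϑ + scoringCorrection Θ T lam N k x ϑ ϑ

/-- The two-step MLE computed from the value `ϑ` of the first preliminary estimate: in the second
correction the Fisher information and the score are still taken at `ϑ`, and only the compensator is
taken at the second preliminary estimate. -/
noncomputable def twoStepMLE (Θ : Set (EuclideanSpace ℝ (Fin d))) (T : Set ℝ)
    (lam : EuclideanSpace ℝ (Fin d) → ℝ → ℝ) (N k : ℕ) (x : ℕ → StieltjesFunction ℝ)
    (ϑ : EuclideanSpace ℝ (Fin d)) : EuclideanSpace ℝ (Fin d) :=
  secondPreliminary Θ T lam N k x ϑ +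
    scoringCorrection Θ T lam N k x ϑ (secondPreliminary Θ T lam N k x ϑ)

end Model

/-! The linear statistics `∫ f dX - ∫ f lam` of a Poisson process are centered with variance
`∫ f² lam`; both moments come from those of the counts of `X` on measurable sets. Hence the
normalized score of the observations `N + 1, …, k` satisfies Chebyshev bounds and a central limit
theorem. The first estimate depends on the first `N` observations only, so conditionally on it the
score increment between it and `ϑ₀` is again a centered linear statistic, of small variance.

On the event where these statistics are of their typical size, each scoring correction is a Newton
step with a quadratic error: starting from an error of order `N ^ (-1 / 2)`, the second preliminary
estimate has an error of order `k ^ (-1 / 2) + N⁻¹`, and the two-step estimate equals its linear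
part up to `o (k ^ (-1 / 2))` as soon as `k` is negligible against `N ^ 3`, that is, for
`δ > 1 / 3`. -/

section

open scoped ENNReal NNReal RealInnerProductSpace

/-! ### Paths and their jump measures -/

/-- The σ-algebra on paths generated by the evaluations at all times. -/
instance pathMeasurableSpace : MeasurableSpace (StieltjesFunction ℝ) :=
  MeasurableSpace.comap (fun x t => x t) MeasurableSpace.pi

lemma measurable_path_coe : Measurable fun (x : StieltjesFunction ℝ) (t : ℝ) => x t :=
  comap_measurable _

lemma measurable_path_eval (t : ℝ) : Measurable fun x : StieltjesFunction ℝ => x t :=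
  (measurable_pi_apply t).comp measurable_path_coe

lemma measurable_path_of_eval {α : Type*} [MeasurableSpace α] {X : α → StieltjesFunction ℝ}
    (hX : ∀ t, Measurable fun a => X a t) : Measurable X :=
  measurable_comap_iff.2 (measurable_pi_lambda _ hX)

lemma tendsto_measure_Ioc_neg_natCast_Iic (μ : Measure ℝ) (a : ℝ) :
    Tendsto (fun n : ℕ => μ (Set.Ioc (-(n : ℝ)) a)) atTop (𝓝 (μ (Set.Iic a))) :=
  (tendsto_measure_Ioc_atBot μ a).comp
    (tendsto_neg_atTop_atBot.comp tendsto_natCast_atTop_atTop)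

lemma monotone_Ioc_neg_natCast : Monotone fun n : ℕ => Set.Ioc (-(n : ℝ)) n := fun _ _ hmn =>
  Set.Ioc_subset_Ioc (neg_le_neg (Nat.cast_le.2 hmn)) (Nat.cast_le.2 hmn)

lemma tendsto_measure_Ioc_neg_natCast_univ (μ : Measure ℝ) :
    Tendsto (fun n : ℕ => μ (Set.Ioc (-(n : ℝ)) n)) atTop (𝓝 (μ Set.univ)) := by
  have hU : ⋃ n : ℕ, Set.Ioc (-(n : ℝ)) n = Set.univ := by
    refine Set.eq_univ_of_forall fun t => Set.mem_iUnion.2 ?_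
    obtain ⟨n, hn⟩ := exists_nat_gt |t|
    exact ⟨n, (abs_lt.1 hn).1, (abs_lt.1 hn).2.le⟩
  rw [← hU]
  exact tendsto_measure_iUnion_atTop monotone_Ioc_neg_natCast

lemma measurable_measure_Ioc (a b : ℝ) :
    Measurable fun x : StieltjesFunction ℝ => x.measure (Set.Ioc a b) := by
  simp only [StieltjesFunction.measure_Ioc]
  exact ((measurable_path_eval b).sub (measurable_path_eval a)).ennreal_ofReal

lemma measurable_measure_univ :
    Measurable fun x : StieltjesFunction ℝ => x.measure Set.univ :=
  measurable_of_tendsto_metrizable (fun n : ℕ => measurable_measure_Ioc (-(n : ℝ)) n)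
    (tendsto_pi_nhds.2 fun x => tendsto_measure_Ioc_neg_natCast_univ x.measure)

open scoped Classical in
/-- The measure counting the jumps of a path. Paths with infinite total variation get the measure
`0`, which makes the jump measure finite for every path. -/
noncomputable def jumpMeasure (x : StieltjesFunction ℝ) : Measure ℝ :=
  if x.measure Set.univ < ∞ then x.measure else 0

instance isFiniteMeasure_jumpMeasure (x : StieltjesFunction ℝ) :
    IsFiniteMeasure (jumpMeasure x) := by
  unfold jumpMeasure
  split_ifs with h
  · exact ⟨h⟩
  · infer_instance

lemma jumpMeasure_of_lt_top {x : StieltjesFunction ℝ} (hx : x.measure Set.univ < ∞) :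
    jumpMeasure x = x.measure :=
  if_pos hx

lemma measurable_jumpMeasure : Measurable jumpMeasure := by
  have measurable_apply : ∀ A : Set ℝ,
      Measurable (fun x : StieltjesFunction ℝ => x.measure A) →
        Measurable fun x => jumpMeasure x A := by
    intro A hA
    have : (fun x => jumpMeasure x A) = fun x : StieltjesFunction ℝ =>
        if x.measure Set.univ < ∞ then x.measure A else 0 := by
      ext x
      unfold jumpMeasure
      split_ifs <;> simp
    rw [this]
    exact hA.ite (measurableSet_lt measurable_measure_univ measurable_const) measurable_const
  refine Measurable.measure_of_isPiSystem (BorelSpace.measurable_eq.trans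
    (borel_eq_generateFrom_Ioc ℝ)) (isPiSystem_Ioc id id) ?_
    (measurable_apply _ measurable_measure_univ)
  rintro _ ⟨a, b, -, rfl⟩
  exact measurable_apply _ (measurable_measure_Ioc a b)

/-- The jump measure as a kernel from paths to times. -/
noncomputable def jumpKernel : Kernel (StieltjesFunction ℝ) ℝ :=
  ⟨jumpMeasure, measurable_jumpMeasure⟩

lemma jumpKernel_apply (x : StieltjesFunction ℝ) : jumpKernel x = jumpMeasure x := rfl

lemma isSFiniteKernel_of_isFiniteMeasure {α β : Type*} [MeasurableSpace α] [MeasurableSpace β]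
    (κ : Kernel α β) [∀ a, IsFiniteMeasure (κ a)] : IsSFiniteKernel κ := by
  have hlevel : ∀ n : ℕ, MeasurableSet {a | ⌊(κ a).real Set.univ⌋₊ = n} := fun n =>
    (κ.measurable_coe .univ).ennreal_toReal.nat_floor (measurableSet_singleton n)
  classical
  refine ⟨fun n => Kernel.piecewise (hlevel n) κ 0, fun n =>
    ⟨ENNReal.ofReal (n + 1), ENNReal.ofReal_lt_top, fun a => ?_⟩, ?_⟩
  · rw [Kernel.piecewise_apply]
    split_ifs with h
    · rw [← ofReal_measureReal, ← show ⌊(κ a).real Set.univ⌋₊ = n from h]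
      exact ENNReal.ofReal_le_ofReal (Nat.lt_floor_add_one _).le
    · simp
  · ext a s hs
    rw [Kernel.sum_apply' _ _ hs, tsum_eq_single ⌊(κ a).real Set.univ⌋₊,
      Kernel.piecewise_apply, if_pos (by rfl)]
    intro n hn
    rw [Kernel.piecewise_apply, if_neg (fun h => hn h.symm)]
    simp

instance isSFiniteKernel_jumpKernel : IsSFiniteKernel jumpKernel :=
  have : ∀ x, IsFiniteMeasure (jumpKernel x) := isFiniteMeasure_jumpMeasure
  isSFiniteKernel_of_isFiniteMeasure jumpKernel

lemma comp_map_apply {Ω α β : Type*} [MeasurableSpace Ω] [MeasurableSpace α]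
    [MeasurableSpace β] {P : Measure Ω} (κ : Kernel α β) {X : Ω → α} (hX : Measurable X)
    {s : Set β} (hs : MeasurableSet s) : (κ ∘ₘ P.map X) s = ∫⁻ ω, κ (X ω) s ∂P := by
  rw [Measure.bind_apply hs κ.measurable.aemeasurable, lintegral_map (κ.measurable_coe hs) hX]

lemma integrable_integral_comp_map {Ω α β F : Type*} [MeasurableSpace Ω] [MeasurableSpace α]
    [MeasurableSpace β] [NormedAddCommGroup F] [NormedSpace ℝ F] {P : Measure Ω}
    (κ : Kernel α β) {X : Ω → α} (hX : Measurable X) {f : β → F}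
    (hf : StronglyMeasurable f) (hfi : Integrable f (κ ∘ₘ P.map X)) :
    Integrable (fun ω => ∫ t, f t ∂(κ (X ω))) P := by
  rw [Measure.comp_eq_comp_const_apply] at hfi
  simpa only [Kernel.const_apply, Function.comp_def, integrable_map_measure
    hf.integral_kernel.aestronglyMeasurable hX.aemeasurable] using hfi.integral_comp

lemma integral_integral_comp_map {Ω α β F : Type*} [MeasurableSpace Ω] [MeasurableSpace α]
    [MeasurableSpace β] [NormedAddCommGroup F] [NormedSpace ℝ F] {P : Measure Ω}
    (κ : Kernel α β) {X : Ω → α} (hX : Measurable X) {f : β → F}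
    (hf : StronglyMeasurable f) (hfi : Integrable f (κ ∘ₘ P.map X)) :
    ∫ ω, ∫ t, f t ∂(κ (X ω)) ∂P = ∫ t, f t ∂(κ ∘ₘ P.map X) := by
  rw [Measure.comp_eq_comp_const_apply] at hfi ⊢
  rw [Kernel.integral_comp hfi, Kernel.const_apply,
    integral_map hX.aemeasurable hf.integral_kernel.aestronglyMeasurable]

lemma monotone_finCons {α : Type*} [Preorder α] {n : ℕ} {a : α} {u : Fin n → α}
    (ha : ∀ i, a ≤ u i) (hu : Monotone u) :
    Monotone (Fin.cons a u : Fin (n + 1) → α) := by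
  refine Fin.cases (fun j _ => ?_) (fun i => Fin.cases (fun hij => ?_) fun j hij => ?_)
  · exact Fin.cases le_rfl ha j
  · exact absurd hij (Fin.succ_pos i).not_ge
  · exact hu (Fin.succ_le_succ_iff.1 hij)

/-! ### Moments of the Poisson distribution -/

lemma lintegral_poissonMeasure (r : ℝ≥0) (g : ℕ → ℝ≥0∞) :
    ∫⁻ n, g n ∂(poissonMeasure r) =
      ∑' n : ℕ, ENNReal.ofReal (Real.exp (-r) * r ^ n / (n.factorial : ℝ)) * g n := by
  rw [lintegral_countable']
  exact tsum_congr fun n => by rw [poissonMeasure_singleton, mul_comm]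

lemma lintegral_natCast_mul_poissonMeasure (r : ℝ≥0) (g : ℕ → ℝ≥0∞) :
    ∫⁻ n : ℕ, (n : ℝ≥0∞) * g n ∂(poissonMeasure r) =
      r * ∫⁻ n, g (n + 1) ∂(poissonMeasure r) := by
  have size_bias : ∀ n : ℕ,
      ENNReal.ofReal (Real.exp (-r) * r ^ (n + 1) / ((n + 1).factorial : ℝ)) *
        ((n + 1 : ℕ) : ℝ≥0∞) =
      r * ENNReal.ofReal (Real.exp (-r) * r ^ n / (n.factorial : ℝ)) := by
    intro n
    rw [← ENNReal.ofReal_natCast, ← ENNReal.ofReal_mul (by positivity),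
      ← ENNReal.ofReal_coe_nnreal, ← ENNReal.ofReal_mul (by positivity), Nat.factorial_succ]
    congr 1
    push_cast
    field_simp
    ring
  rw [lintegral_poissonMeasure, lintegral_poissonMeasure,
    tsum_eq_zero_add' ENNReal.summable, ← ENNReal.tsum_mul_left]
  simp only [Nat.cast_zero, zero_mul, mul_zero, zero_add]
  exact tsum_congr fun n => by rw [← mul_assoc, size_bias, mul_assoc]

lemma lintegral_natCast_poissonMeasure (r : ℝ≥0) :
    ∫⁻ n : ℕ, (n : ℝ≥0∞) ∂(poissonMeasure r) = r := by
  simpa using lintegral_natCast_mul_poissonMeasure r 1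

lemma lintegral_natCast_mul_self_poissonMeasure (r : ℝ≥0) :
    ∫⁻ n : ℕ, (n : ℝ≥0∞) * n ∂(poissonMeasure r) = r + r * r := by
  rw [lintegral_natCast_mul_poissonMeasure]
  simp only [Nat.cast_add, Nat.cast_one]
  rw [lintegral_add_right _ measurable_const, lintegral_natCast_poissonMeasure, lintegral_const,
    measure_univ]
  ring

/-! ### Poisson paths with a given mean measure -/

/-- `X` is a random path starting from `0` with independent increments, the increment over
`(a, b]` having the Poisson law with mean `Λ (a, b]`. This is the Poisson process with mean measure
`Λ`, described without reference to a density or to an observation window. -/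
structure IsPoissonPath {Ω : Type*} [MeasurableSpace Ω] (P : Measure Ω) (Λ : Measure ℝ)
    (X : Ω → StieltjesFunction ℝ) : Prop where
  measurable : Measurable X
  start_zero : ∀ ω, Tendsto (X ω) atBot (𝓝 0)
  indep_increments : HasIndepIncrements (fun (t : ℝ) (ω : Ω) => X ω t) P
  map_increment : ∀ a b, a ≤ b → ∃ Y : Ω → ℕ, Measurable Y ∧ (∀ ω, X ω b - X ω a = Y ω) ∧
    P.map Y = poissonMeasure (Λ (Set.Ioc a b)).toNNReal

namespace IsPoissonPath

variable {Ω : Type*} [MeasurableSpace Ω] {P : Measure Ω} {Λ : Measure ℝ}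
  {X : Ω → StieltjesFunction ℝ}

lemma measurable_eval (hX : IsPoissonPath P Λ X) (t : ℝ) : Measurable fun ω => X ω t :=
  (measurable_path_eval t).comp hX.measurable

lemma measurable_measure_Ioc (hX : IsPoissonPath P Λ X) (a b : ℝ) :
    Measurable fun ω => (X ω).measure (Set.Ioc a b) :=
  (_root_.measurable_measure_Ioc a b).comp hX.measurable

lemma map_increments_eq_pi [IsProbabilityMeasure P] (hX : IsPoissonPath P Λ X) {n : ℕ}
    {τ : Fin (n + 1) → ℝ} (hτ : Monotone τ) :
    P.map (fun ω (i : Fin n) => X ω (τ i.succ) - X ω (τ i.castSucc)) =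
      Measure.pi fun i : Fin n => (poissonMeasure
        (Λ (Set.Ioc (τ i.castSucc) (τ i.succ))).toNNReal).map fun j : ℕ => (j : ℝ) := by
  have hm : ∀ i : Fin n, Measurable fun ω => X ω (τ i.succ) - X ω (τ i.castSucc) := fun i =>
    (hX.measurable_eval _).sub (hX.measurable_eval _)
  rw [(iIndepFun_iff_map_fun_eq_pi_map fun i => (hm i).aemeasurable).1
    (hX.indep_increments n τ hτ)]
  congr 1
  ext1 i
  obtain ⟨Y, hY, hXY, hl⟩ := hX.map_increment _ _ (hτ (Fin.castSucc_le_succ i))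
  rw [← hl, Measure.map_map .of_discrete hY]
  exact congrArg P.map (funext hXY)

lemma map_sub_eq [IsProbabilityMeasure P] (hX : IsPoissonPath P Λ X)
    {Y : Ω → StieltjesFunction ℝ} (hY : IsPoissonPath P Λ Y) (I : Finset ℝ) {c : ℝ}
    (hc : ∀ t ∈ I, c ≤ t) :
    P.map (fun ω (t : I) => X ω t - X ω c) = P.map fun ω (t : I) => Y ω t - Y ω c := by
  let τ : Fin (I.card + 1) → ℝ := Fin.cons c (I.orderEmbOfFin rfl)
  have hτ : Monotone τ :=
    monotone_finCons (fun i => hc _ (I.orderEmbOfFin_mem rfl i)) (I.orderEmbOfFin rfl).monotone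
  let partialSum : (Fin I.card → ℝ) → I → ℝ := fun x t =>
    ∑ j ≤ (I.orderIsoOfFin rfl).symm t, x j
  have map_eq : ∀ {Z : Ω → StieltjesFunction ℝ}, IsPoissonPath P Λ Z →
      P.map (fun ω (t : I) => Z ω t - Z ω c) =
        (P.map fun ω (i : Fin I.card) => Z ω (τ i.succ) - Z ω (τ i.castSucc)).map
          partialSum := by
    intro Z hZ
    have hm : ∀ i : Fin I.card, Measurable fun ω => Z ω (τ i.succ) - Z ω (τ i.castSucc) :=
      fun i => (hZ.measurable_eval _).sub (hZ.measurable_eval _)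
    rw [Measure.map_map (by fun_prop) (measurable_pi_lambda _ hm)]
    congr 1
    ext ω t
    simp only [Function.comp_apply, partialSum]
    rw [Fin.sum_Iic_sub _ (fun j => Z ω (τ j))]
    simp only [τ, Fin.cons_zero, Fin.cons_succ, ← Finset.coe_orderIsoOfFin_apply,
      OrderIso.apply_symm_apply]
  rw [map_eq hX, map_eq hY, hX.map_increments_eq_pi hτ, hY.map_increments_eq_pi hτ]

lemma tendstoInDistribution_restrict_sub [IsProbabilityMeasure P] (hX : IsPoissonPath P Λ X)
    (I : Finset ℝ) :
    TendstoInDistribution (fun (n : ℕ) ω (t : I) => X ω t - X ω (-(n : ℝ))) atTop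
      (fun ω (t : I) => X ω t) (fun _ => P) P := by
  refine tendstoInDistribution_of_ae_tendsto (fun n => (measurable_pi_lambda _ fun t =>
      (hX.measurable_eval _).sub (hX.measurable_eval _)).aemeasurable)
    (measurable_pi_lambda _ fun t => hX.measurable_eval _).aemeasurable
    (.of_forall fun ω => tendsto_pi_nhds.2 fun t => ?_)
  have hneg : Tendsto (fun n : ℕ => -(n : ℝ)) atTop atBot :=
    tendsto_neg_atTop_atBot.comp tendsto_natCast_atTop_atTop
  simpa only [sub_zero, Function.comp_def] using ((hX.start_zero ω).comp hneg).const_sub (X ω t)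

lemma map_restrict_eq [IsProbabilityMeasure P] (hX : IsPoissonPath P Λ X)
    {Y : Ω → StieltjesFunction ℝ} (hY : IsPoissonPath P Λ Y) (I : Finset ℝ) :
    P.map (fun ω (t : I) => X ω t) = P.map fun ω (t : I) => Y ω t := by
  have hXI := hX.tendstoInDistribution_restrict_sub I
  have hYI := hY.tendstoInDistribution_restrict_sub I
  refine tendstoInDistribution_unique _ hXI
    ⟨hXI.forall_aemeasurable, hYI.aemeasurable_limit, hYI.tendsto.congr' ?_⟩
  obtain ⟨m, hm⟩ := I.bddBelow
  filter_upwards [eventually_ge_atTop ⌈-m⌉₊] with n hn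
  exact Subtype.ext (hY.map_sub_eq hX I fun t ht =>
    (neg_le.1 (Nat.ceil_le.1 hn)).trans (hm ht))

lemma map_eq [IsProbabilityMeasure P] (hX : IsPoissonPath P Λ X)
    {Y : Ω → StieltjesFunction ℝ} (hY : IsPoissonPath P Λ Y) : P.map X = P.map Y := by
  have hXm : Measurable fun ω t => X ω t := measurable_path_coe.comp hX.measurable
  have hYm : Measurable fun ω t => Y ω t := measurable_path_coe.comp hY.measurable
  have hcoe : P.map (fun ω t => X ω t) = P.map fun ω t => Y ω t :=
    (map_eq_iff_forall_finset_map_restrict_eq (X := fun t ω => X ω t) (Y := fun t ω => Y ω t)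
      hXm.aemeasurable hYm.aemeasurable).2 fun I => hX.map_restrict_eq hY I
  ext s hs
  obtain ⟨s', hs', rfl⟩ := hs
  rw [Measure.map_apply hX.measurable (measurable_path_coe hs'),
    Measure.map_apply hY.measurable (measurable_path_coe hs')]
  have := congrArg (· s') hcoe
  rwa [Measure.map_apply hXm hs', Measure.map_apply hYm hs'] at this

variable [IsFiniteMeasure Λ]

lemma lintegral_measure_Ioc (hX : IsPoissonPath P Λ X) (a b : ℝ) :
    ∫⁻ ω, (X ω).measure (Set.Ioc a b) ∂P = Λ (Set.Ioc a b) := by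
  obtain hab | hba := le_or_gt a b
  · obtain ⟨Y, hY, hXY, hl⟩ := hX.map_increment a b hab
    simp only [StieltjesFunction.measure_Ioc, hXY, ENNReal.ofReal_natCast]
    rw [← lintegral_map (f := fun n : ℕ => (n : ℝ≥0∞)) .of_discrete hY, hl,
      lintegral_natCast_poissonMeasure, ENNReal.coe_toNNReal (measure_ne_top _ _)]
  · simp [Set.Ioc_eq_empty hba.not_gt]

lemma lintegral_measure_Ioc_mul_self (hX : IsPoissonPath P Λ X) {a b : ℝ} (hab : a ≤ b) :
    ∫⁻ ω, (X ω).measure (Set.Ioc a b) * (X ω).measure (Set.Ioc a b) ∂P =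
      Λ (Set.Ioc a b) + Λ (Set.Ioc a b) * Λ (Set.Ioc a b) := by
  obtain ⟨Y, hY, hXY, hl⟩ := hX.map_increment a b hab
  simp only [StieltjesFunction.measure_Ioc, hXY, ENNReal.ofReal_natCast]
  rw [← lintegral_map (f := fun n : ℕ => (n : ℝ≥0∞) * n) .of_discrete hY, hl,
    lintegral_natCast_mul_self_poissonMeasure, ENNReal.coe_toNNReal (measure_ne_top _ _)]

lemma lintegral_measure_Ioc_mul_adjacent (hX : IsPoissonPath P Λ X) {a b c : ℝ} (hab : a ≤ b)
    (hbc : b ≤ c) :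
    ∫⁻ ω, (X ω).measure (Set.Ioc a b) * (X ω).measure (Set.Ioc b c) ∂P =
      Λ (Set.Ioc a b) * Λ (Set.Ioc b c) := by
  rw [← hX.lintegral_measure_Ioc a b, ← hX.lintegral_measure_Ioc b c]
  refine lintegral_mul_eq_lintegral_mul_lintegral_of_indepFun (hX.measurable_measure_Ioc a b)
    (hX.measurable_measure_Ioc b c) ?_
  simpa only [StieltjesFunction.measure_Ioc, Function.comp_def, Pi.sub_apply] using
    (hX.indep_increments.indepFun_sub_sub hab hbc).comp
      ENNReal.measurable_ofReal ENNReal.measurable_ofReal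

lemma lintegral_measure_Ioc_mul_of_le (hX : IsPoissonPath P Λ X) {c a b : ℝ} (hca : c ≤ a)
    (hab : a ≤ b) :
    ∫⁻ ω, (X ω).measure (Set.Ioc c a) * (X ω).measure (Set.Ioc c b) ∂P =
      Λ (Set.Ioc c a) + Λ (Set.Ioc c a) * Λ (Set.Ioc c b) := by
  have split : ∀ μ : Measure ℝ, μ (Set.Ioc c b) = μ (Set.Ioc c a) + μ (Set.Ioc a b) := fun μ => by
    rw [← Set.Ioc_union_Ioc_eq_Ioc hca hab,
      measure_union (Set.Ioc_disjoint_Ioc_of_le le_rfl) measurableSet_Ioc]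
  have hm := hX.measurable_measure_Ioc c a
  simp only [split, mul_add]
  rw [lintegral_add_left (by fun_prop), hX.lintegral_measure_Ioc_mul_self hca,
    hX.lintegral_measure_Ioc_mul_adjacent hca hab, add_assoc]

lemma lintegral_measure_Ioc_mul (hX : IsPoissonPath P Λ X) (c a b : ℝ) :
    ∫⁻ ω, (X ω).measure (Set.Ioc c a) * (X ω).measure (Set.Ioc c b) ∂P =
      Λ (Set.Ioc c (a ⊓ b)) + Λ (Set.Ioc c a) * Λ (Set.Ioc c b) := by
  wlog hab : a ≤ b generalizing a b
  · simpa only [inf_comm, mul_comm] using this b a (le_of_not_ge hab)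
  rw [inf_eq_left.2 hab]
  obtain hca | hac := le_or_gt c a
  · exact hX.lintegral_measure_Ioc_mul_of_le hca hab
  · simp [Set.Ioc_eq_empty hac.not_gt]

lemma lintegral_measure_univ (hX : IsPoissonPath P Λ X) :
    ∫⁻ ω, (X ω).measure Set.univ ∂P = Λ Set.univ := by
  refine tendsto_nhds_unique (lintegral_tendsto_of_tendsto_of_monotone
    (fun n : ℕ => (hX.measurable_measure_Ioc (-(n : ℝ)) n).aemeasurable)
    (.of_forall fun ω _ _ hmn => measure_mono (monotone_Ioc_neg_natCast hmn))
    (.of_forall fun ω => tendsto_measure_Ioc_neg_natCast_univ (X ω).measure)) ?_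
  simp only [hX.lintegral_measure_Ioc]
  exact tendsto_measure_Ioc_neg_natCast_univ Λ

lemma ae_measure_univ_lt_top (hX : IsPoissonPath P Λ X) :
    ∀ᵐ ω ∂P, (X ω).measure Set.univ < ∞ :=
  ae_lt_top (measurable_measure_univ.comp hX.measurable)
    (hX.lintegral_measure_univ.trans_ne (measure_ne_top _ _))

lemma ae_jumpMeasure_eq (hX : IsPoissonPath P Λ X) :
    ∀ᵐ ω ∂P, jumpMeasure (X ω) = (X ω).measure :=
  hX.ae_measure_univ_lt_top.mono fun _ => jumpMeasure_of_lt_top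

lemma lintegral_measure_Iic_mul (hX : IsPoissonPath P Λ X) (a b : ℝ) :
    ∫⁻ ω, (X ω).measure (Set.Iic a) * (X ω).measure (Set.Iic b) ∂P =
      Λ (Set.Iic (a ⊓ b)) + Λ (Set.Iic a) * Λ (Set.Iic b) := by
  have tendsto_mul : ∀ μ : Measure ℝ, μ Set.univ < ∞ → Tendsto (fun n : ℕ =>
      μ (Set.Ioc (-(n : ℝ)) a) * μ (Set.Ioc (-(n : ℝ)) b)) atTop
        (𝓝 (μ (Set.Iic a) * μ (Set.Iic b))) := fun μ hμ =>
    have : IsFiniteMeasure μ := ⟨hμ⟩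
    ENNReal.Tendsto.mul (tendsto_measure_Ioc_neg_natCast_Iic μ a) (.inr (measure_ne_top _ _))
      (tendsto_measure_Ioc_neg_natCast_Iic μ b) (.inr (measure_ne_top _ _))
  refine tendsto_nhds_unique (lintegral_tendsto_of_tendsto_of_monotone (fun n : ℕ =>
    ((hX.measurable_measure_Ioc (-(n : ℝ)) a).mul
      (hX.measurable_measure_Ioc (-(n : ℝ)) b)).aemeasurable)
    (.of_forall fun ω m n hmn => ?_)
    (hX.ae_measure_univ_lt_top.mono fun ω hω => tendsto_mul _ hω)) ?_
  · have hle : -(n : ℝ) ≤ -(m : ℝ) := neg_le_neg (Nat.cast_le.2 hmn)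
    exact mul_le_mul' (measure_mono (Set.Ioc_subset_Ioc_left hle))
      (measure_mono (Set.Ioc_subset_Ioc_left hle))
  · simp only [Pi.mul_apply, hX.lintegral_measure_Ioc_mul]
    exact (tendsto_measure_Ioc_neg_natCast_Iic Λ _).add (tendsto_mul Λ (measure_lt_top _ _))

lemma comp_map_jumpKernel (hX : IsPoissonPath P Λ X) : jumpKernel ∘ₘ P.map X = Λ := by
  have hIoc : ∀ a b, (jumpKernel ∘ₘ P.map X) (Set.Ioc a b) = Λ (Set.Ioc a b) := fun a b => by
    rw [comp_map_apply _ hX.measurable measurableSet_Ioc, ← hX.lintegral_measure_Ioc]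
    exact lintegral_congr_ae (hX.ae_jumpMeasure_eq.mono fun ω hω =>
      congrArg (· (Set.Ioc a b)) hω)
  exact Measure.ext_of_Ioc' _ _ (fun a b _ => (hIoc a b).trans_ne (measure_ne_top _ _))
    fun a b _ => hIoc a b

lemma comp_map_jumpKernel_prod_jumpKernel_Iic (hX : IsPoissonPath P Λ X) (a b : ℝ) :
    ((jumpKernel ×ₖ jumpKernel) ∘ₘ P.map X) (Set.Iic a ×ˢ Set.Iic b) =
      (Λ.prod Λ + Λ.map fun t => (t, t)) (Set.Iic a ×ˢ Set.Iic b) := by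
  have hs : MeasurableSet (Set.Iic a ×ˢ Set.Iic b) := measurableSet_Iic.prod measurableSet_Iic
  have hdiag : (fun t : ℝ => (t, t)) ⁻¹' (Set.Iic a ×ˢ Set.Iic b) = Set.Iic (a ⊓ b) := by
    ext t
    simp
  rw [comp_map_apply _ hX.measurable hs, Measure.add_apply, Measure.prod_prod,
    Measure.map_apply (by fun_prop) hs, hdiag, add_comm, ← hX.lintegral_measure_Iic_mul]
  refine lintegral_congr_ae ?_
  filter_upwards [hX.ae_jumpMeasure_eq] with ω hω
  rw [Kernel.prod_apply, jumpKernel_apply, Measure.prod_prod, hω]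

lemma comp_map_jumpKernel_prod_jumpKernel (hX : IsPoissonPath P Λ X) :
    (jumpKernel ×ₖ jumpKernel) ∘ₘ P.map X = Λ.prod Λ + Λ.map fun t => (t, t) := by
  have hspan : IsCountablySpanning (Set.range (Set.Iic : ℝ → Set ℝ)) :=
    ⟨fun n : ℕ => Set.Iic (n : ℝ), fun n => ⟨_, rfl⟩,
      Set.eq_univ_of_forall fun t => Set.mem_iUnion.2 (exists_nat_ge t)⟩
  have hgen : MeasurableSpace.generateFrom (Set.range (Set.Iic : ℝ → Set ℝ)) =
      Real.measurableSpace := (BorelSpace.measurable_eq.trans (borel_eq_generateFrom_Iic ℝ)).symm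
  refine Measure.ext_of_generateFrom_of_iUnion _
    (fun n : ℕ => Set.Iic (n : ℝ) ×ˢ Set.Iic (n : ℝ))
    (generateFrom_eq_prod hgen hgen hspan hspan).symm (isPiSystem_Iic.prod isPiSystem_Iic) ?_
    (fun n => ⟨_, ⟨_, rfl⟩, _, ⟨_, rfl⟩, rfl⟩) (fun n => ?_) ?_
  · refine Set.eq_univ_of_forall fun p => Set.mem_iUnion.2 ?_
    obtain ⟨n, hn⟩ := exists_nat_ge (p.1 ⊔ p.2)
    exact ⟨n, le_sup_left.trans hn, le_sup_right.trans hn⟩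
  · exact (hX.comp_map_jumpKernel_prod_jumpKernel_Iic n n).trans_ne (measure_ne_top _ _)
  · rintro _ ⟨_, ⟨a, rfl⟩, _, ⟨b, rfl⟩, rfl⟩
    exact hX.comp_map_jumpKernel_prod_jumpKernel_Iic a b

lemma integral_integral_jumpMeasure {F : Type*} [NormedAddCommGroup F] [NormedSpace ℝ F]
    (hX : IsPoissonPath P Λ X) {f : ℝ → F} (hf : StronglyMeasurable f) (hfi : Integrable f Λ) :
    ∫ ω, ∫ t, f t ∂(jumpMeasure (X ω)) ∂P = ∫ t, f t ∂Λ := by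
  rw [← hX.comp_map_jumpKernel] at hfi
  simpa only [jumpKernel_apply, hX.comp_map_jumpKernel] using
    integral_integral_comp_map jumpKernel hX.measurable hf hfi

lemma integrable_mul_map_diag {f : ℝ → ℝ} (hf : StronglyMeasurable f) (hfL : MemLp f 2 Λ) :
    Integrable (fun p : ℝ × ℝ => f p.1 * f p.2) (Λ.prod Λ + Λ.map fun t => (t, t)) := by
  have hfi : Integrable f Λ := hfL.integrable one_le_two
  have hdiag : Integrable (fun p : ℝ × ℝ => f p.1 * f p.2) (Λ.map fun t => (t, t)) := by
    rw [integrable_map_measure (by fun_prop) (by fun_prop)]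
    simpa only [Function.comp_def, sq] using hfL.integrable_sq
  exact (hfi.mul_prod hfi).add_measure hdiag

lemma integral_mul_jumpKernel_prod (f : ℝ → ℝ) (x : StieltjesFunction ℝ) :
    ∫ p, f p.1 * f p.2 ∂((jumpKernel ×ₖ jumpKernel) x) = (∫ t, f t ∂(jumpMeasure x)) ^ 2 := by
  rw [Kernel.prod_apply, jumpKernel_apply, integral_prod_mul, sq]

lemma integrable_integral_jumpMeasure_sq (hX : IsPoissonPath P Λ X) {f : ℝ → ℝ}
    (hf : StronglyMeasurable f) (hfL : MemLp f 2 Λ) :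
    Integrable (fun ω => (∫ t, f t ∂(jumpMeasure (X ω))) ^ 2) P := by
  have hF := integrable_mul_map_diag hf hfL
  rw [← hX.comp_map_jumpKernel_prod_jumpKernel] at hF
  simpa only [integral_mul_jumpKernel_prod] using integrable_integral_comp_map
    (jumpKernel ×ₖ jumpKernel) hX.measurable (by fun_prop) hF

lemma integral_integral_jumpMeasure_sq (hX : IsPoissonPath P Λ X) {f : ℝ → ℝ}
    (hf : StronglyMeasurable f) (hfL : MemLp f 2 Λ) :
    ∫ ω, (∫ t, f t ∂(jumpMeasure (X ω))) ^ 2 ∂P = (∫ t, f t ∂Λ) ^ 2 + ∫ t, f t ^ 2 ∂Λ := by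
  have hF := integrable_mul_map_diag hf hfL
  have hF' := hF
  rw [← hX.comp_map_jumpKernel_prod_jumpKernel] at hF'
  simp only [← integral_mul_jumpKernel_prod]
  rw [integral_integral_comp_map (jumpKernel ×ₖ jumpKernel) hX.measurable (by fun_prop) hF',
    hX.comp_map_jumpKernel_prod_jumpKernel, integral_add_measure
      (hF.mono_measure (Measure.le_add_right le_rfl))
      (hF.mono_measure (Measure.le_add_left le_rfl)),
    integral_prod_mul, integral_map (by fun_prop) (by fun_prop)]
  simp only [sq]

end IsPoissonPath

/-! ### Poisson processes with an intensity function -/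

/-- The mean measure on `T` with intensity `lam`. -/
noncomputable def intensityMeasure (T : Set ℝ) (lam : ℝ → ℝ) : Measure ℝ :=
  (volume.restrict T).withDensity fun t => ENNReal.ofReal (lam t)

lemma isFiniteMeasure_intensityMeasure {T : Set ℝ} {lam : ℝ → ℝ} (hi : IntegrableOn lam T) :
    IsFiniteMeasure (intensityMeasure T lam) :=
  isFiniteMeasure_withDensity_ofReal hi.2

lemma intensityMeasure_apply {T : Set ℝ} (hT : MeasurableSet T) {lam : ℝ → ℝ}
    (hi : IntegrableOn lam T) (hnn : ∀ t ∈ T, 0 ≤ lam t) {s : Set ℝ} (hs : MeasurableSet s) :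
    intensityMeasure T lam s = ENNReal.ofReal (∫ t in s ∩ T, lam t) := by
  rw [intensityMeasure, withDensity_apply _ hs, Measure.restrict_restrict hs,
    ofReal_integral_eq_lintegral_ofReal (hi.mono_set Set.inter_subset_right)]
  exact (ae_restrict_iff' (hs.inter hT)).2 (.of_forall fun t ht => hnn t ht.2)

lemma integral_intensityMeasure {T : Set ℝ} (hT : MeasurableSet T) {lam : ℝ → ℝ}
    (hi : IntegrableOn lam T) (hnn : ∀ t ∈ T, 0 ≤ lam t) {E : Type*} [NormedAddCommGroup E]
    [NormedSpace ℝ E] (f : ℝ → E) :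
    ∫ t, f t ∂(intensityMeasure T lam) = ∫ t in T, lam t • f t := by
  rw [intensityMeasure, integral_withDensity_eq_integral_toReal_smul₀
    hi.1.aemeasurable.ennreal_ofReal (.of_forall fun t => ENNReal.ofReal_lt_top)]
  refine setIntegral_congr_fun hT fun t ht => ?_
  simp only [ENNReal.toReal_ofReal (hnn t ht)]

namespace IsPoissonProcess

variable {Ω : Type*} [MeasurableSpace Ω] {P : Measure Ω} {T : Set ℝ} {lam : ℝ → ℝ}
  {X : Ω → StieltjesFunction ℝ}

lemma sub_eq_natCast_floor (hX : IsPoissonProcess P T lam X) {a b : ℝ} (hab : a ≤ b) (ω : Ω) :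
    X ω b - X ω a = ⌊X ω b - X ω a⌋₊ := by
  obtain ⟨m, hm⟩ := hX.counting ω b
  obtain ⟨l, hl⟩ := hX.counting ω a
  have hlm : (l : ℝ) ≤ m := hl ▸ hm ▸ (X ω).mono hab
  rw [hm, hl, ← Nat.cast_sub (Nat.cast_le.1 hlm), Nat.floor_natCast]

lemma increment_law_of_le [IsProbabilityMeasure P] (hX : IsPoissonProcess P T lam X) {a b : ℝ}
    (hab : a ≤ b) (m : ℕ) :
    P {ω | X ω b - X ω a = m} =
      ENNReal.ofReal ((∫ t in Set.Ioc a b ∩ T, lam t) ^ m / (m.factorial : ℝ) *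
        Real.exp (-∫ t in Set.Ioc a b ∩ T, lam t)) := by
  obtain hlt | rfl := hab.lt_or_eq
  · exact hX.increment_law a b hlt m
  · obtain rfl | hm := eq_or_ne m 0
    · simp
    · have : (0 : ℝ) ≠ m := (Nat.cast_ne_zero.2 hm).symm
      simp [hm, this]

lemma isPoissonPath [IsProbabilityMeasure P] (hT : MeasurableSet T) (hi : IntegrableOn lam T)
    (hnn : ∀ t ∈ T, 0 ≤ lam t) (hX : IsPoissonProcess P T lam X) :
    IsPoissonPath P (intensityMeasure T lam) X where
  measurable := measurable_path_of_eval hX.measurable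
  start_zero := hX.start_zero
  indep_increments := hX.indep_increments
  map_increment a b hab := by
    have hfloor : Measurable fun ω => ⌊X ω b - X ω a⌋₊ :=
      ((hX.measurable b).sub (hX.measurable a)).nat_floor
    refine ⟨_, hfloor, hX.sub_eq_natCast_floor hab, Measure.ext_of_singleton fun m => ?_⟩
    have hset : (fun ω => ⌊X ω b - X ω a⌋₊) ⁻¹' {m} = {ω | X ω b - X ω a = m} := by
      ext ω
      simp only [Set.mem_preimage, Set.mem_singleton_iff, Set.mem_ofPred_eq]
      exact ⟨fun h => by rw [hX.sub_eq_natCast_floor hab, h], fun h => by rw [h, Nat.floor_natCast]⟩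
    have hmean : ((intensityMeasure T lam (Set.Ioc a b)).toNNReal : ℝ) =
        ∫ t in Set.Ioc a b ∩ T, lam t := by
      rw [intensityMeasure_apply hT hi hnn measurableSet_Ioc]
      exact ENNReal.toReal_ofReal
        (setIntegral_nonneg (measurableSet_Ioc.inter hT) fun t ht => hnn t ht.2)
    rw [Measure.map_apply hfloor (measurableSet_singleton m), poissonMeasure_singleton, hset,
      hX.increment_law_of_le hab, hmean]
    congr 1
    ring

end IsPoissonProcess

/-! ### Centered linear statistics of Poisson paths -/

lemma measure_le_norm_le {Ω F : Type*} [MeasurableSpace Ω] [NormedAddCommGroup F] {P : Measure Ω}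
    [IsFiniteMeasure P] {V : Ω → F} (hV : Integrable (fun ω => ‖V ω‖ ^ 2) P) {a : ℝ} (ha : 0 < a) :
    P {ω | a ≤ ‖V ω‖} ≤ ENNReal.ofReal ((∫ ω, ‖V ω‖ ^ 2 ∂P) / a ^ 2) := by
  have hset : {ω | a ≤ ‖V ω‖} = {ω | a ^ 2 ≤ ‖V ω‖ ^ 2} :=
    Set.ext fun ω => (pow_le_pow_iff_left₀ ha.le (norm_nonneg _) two_ne_zero).symm
  rw [hset, ← ofReal_measureReal]
  refine ENNReal.ofReal_le_ofReal ((le_div_iff₀' (by positivity)).2 ?_)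
  exact mul_meas_ge_le_integral_of_nonneg (.of_forall fun ω => sq_nonneg _) hV (a ^ 2)

/-- The centered linear statistic `∫ f dx - ∫ f dΛ` of a path `x`. -/
noncomputable def centeredStat {F : Type*} [NormedAddCommGroup F] [NormedSpace ℝ F]
    (Λ : Measure ℝ) (f : ℝ → F) (x : StieltjesFunction ℝ) : F :=
  (∫ t, f t ∂(jumpMeasure x)) - ∫ t, f t ∂Λ

lemma integrable_of_stronglyMeasurable_of_bounded {α F : Type*} [MeasurableSpace α]
    {μ : Measure α} [IsFiniteMeasure μ] [NormedAddCommGroup F] {f : α → F}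
    (hf : StronglyMeasurable f) {B : ℝ} (hB : ∀ t, ‖f t‖ ≤ B) : Integrable f μ :=
  .of_bound hf.aestronglyMeasurable B (.of_forall hB)

section CenteredStat

variable {F : Type*} [NormedAddCommGroup F] [NormedSpace ℝ F] {Λ : Measure ℝ}

lemma measurable_integral_jumpMeasure [MeasurableSpace F] [BorelSpace F] {f : ℝ → F}
    (hf : StronglyMeasurable f) : Measurable fun x => ∫ t, f t ∂(jumpMeasure x) :=
  (hf.integral_kernel (κ := jumpKernel)).measurable

lemma measurable_centeredStat [MeasurableSpace F] [BorelSpace F] (Λ : Measure ℝ) {f : ℝ → F}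
    (hf : StronglyMeasurable f) : Measurable (centeredStat Λ f) :=
  ((hf.integral_kernel (κ := jumpKernel)).sub stronglyMeasurable_const).measurable

lemma centeredStat_sub {f g : ℝ → F} {x : StieltjesFunction ℝ} (hfx : Integrable f (jumpMeasure x))
    (hgx : Integrable g (jumpMeasure x)) (hf : Integrable f Λ) (hg : Integrable g Λ) :
    centeredStat Λ f x - centeredStat Λ g x = centeredStat Λ (fun t => f t - g t) x := by
  rw [centeredStat, centeredStat, centeredStat, integral_sub hfx hgx, integral_sub hf hg]
  abel

lemma map_centeredStat {G : Type*} [NormedAddCommGroup G] [NormedSpace ℝ G] [CompleteSpace F]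
    [CompleteSpace G] (L : F →L[ℝ] G) {f : ℝ → F} {x : StieltjesFunction ℝ}
    (hfx : Integrable f (jumpMeasure x)) (hf : Integrable f Λ) :
    L (centeredStat Λ f x) = centeredStat Λ (fun t => L (f t)) x := by
  rw [centeredStat, centeredStat, map_sub, L.integral_comp_comm hfx, L.integral_comp_comm hf]

lemma norm_sum_centeredStat_sq [IsFiniteMeasure Λ] {ι : Type*} [Fintype ι]
    {f : ℝ → EuclideanSpace ℝ ι} {B : ℝ} (hf : StronglyMeasurable f) (hB : ∀ t, ‖f t‖ ≤ B)
    (J : Finset ℕ) (x : ℕ → StieltjesFunction ℝ) :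
    ‖∑ j ∈ J, centeredStat Λ f (x j)‖ ^ 2 =
      ∑ i, (∑ j ∈ J, centeredStat Λ (fun t => f t i) (x j)) ^ 2 := by
  rw [EuclideanSpace.real_norm_sq_eq]
  refine Finset.sum_congr rfl fun i _ => ?_
  rw [WithLp.ofLp_sum, Finset.sum_apply]
  refine congrArg (· ^ 2) (Finset.sum_congr rfl fun j _ => ?_)
  exact map_centeredStat (EuclideanSpace.proj (𝕜 := ℝ) i)
    (integrable_of_stronglyMeasurable_of_bounded hf hB)
    (integrable_of_stronglyMeasurable_of_bounded hf hB)

end CenteredStat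

namespace IsPoissonPath

variable {Ω : Type*} [MeasurableSpace Ω] {P : Measure Ω} {Λ : Measure ℝ} [IsFiniteMeasure Λ]

section Single

variable {X : Ω → StieltjesFunction ℝ} {f : ℝ → ℝ}

lemma memLp_integral_jumpMeasure (hX : IsPoissonPath P Λ X) (hf : StronglyMeasurable f)
    (hfL : MemLp f 2 Λ) : MemLp (fun ω => ∫ t, f t ∂(jumpMeasure (X ω))) 2 P :=
  (memLp_two_iff_integrable_sq
    ((measurable_integral_jumpMeasure hf).comp hX.measurable).aestronglyMeasurable).2
    (hX.integrable_integral_jumpMeasure_sq hf hfL)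

variable [IsProbabilityMeasure P]

lemma memLp_centeredStat (hX : IsPoissonPath P Λ X) (hf : StronglyMeasurable f)
    (hfL : MemLp f 2 Λ) : MemLp (fun ω => centeredStat Λ f (X ω)) 2 P :=
  (hX.memLp_integral_jumpMeasure hf hfL).sub (memLp_const _)

lemma integral_centeredStat (hX : IsPoissonPath P Λ X) (hf : StronglyMeasurable f)
    (hfL : MemLp f 2 Λ) : ∫ ω, centeredStat Λ f (X ω) ∂P = 0 := by
  simp only [centeredStat]
  rw [integral_sub ((hX.memLp_integral_jumpMeasure hf hfL).integrable one_le_two)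
    (integrable_const _), hX.integral_integral_jumpMeasure hf (hfL.integrable one_le_two)]
  simp

lemma variance_centeredStat (hX : IsPoissonPath P Λ X) (hf : StronglyMeasurable f)
    (hfL : MemLp f 2 Λ) : Var[fun ω => centeredStat Λ f (X ω); P] = ∫ t, f t ^ 2 ∂Λ := by
  have hL := hX.memLp_integral_jumpMeasure hf hfL
  simp only [centeredStat]
  rw [variance_sub_const hL.1, variance_eq_sub hL]
  simp only [Pi.pow_apply]
  rw [hX.integral_integral_jumpMeasure_sq hf hfL,
    hX.integral_integral_jumpMeasure hf (hfL.integrable one_le_two)]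
  ring

end Single

variable [IsProbabilityMeasure P] {X : ℕ → Ω → StieltjesFunction ℝ}

lemma integral_sum_centeredStat_sq (hX : ∀ j, IsPoissonPath P Λ (X j)) (hind : iIndepFun X P)
    {f : ℝ → ℝ} (hf : StronglyMeasurable f) (hfL : MemLp f 2 Λ) (J : Finset ℕ) :
    ∫ ω, (∑ j ∈ J, centeredStat Λ f (X j ω)) ^ 2 ∂P = J.card * ∫ t, f t ^ 2 ∂Λ := by
  have hL := fun j => (hX j).memLp_centeredStat hf hfL
  have hmean : ∫ ω, ∑ j ∈ J, centeredStat Λ f (X j ω) ∂P = 0 := by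
    rw [integral_finsetSum _ fun j _ => (hL j).integrable one_le_two]
    exact Finset.sum_eq_zero fun j _ => (hX j).integral_centeredStat hf hfL
  have hind' : iIndepFun (fun j ω => centeredStat Λ f (X j ω)) P :=
    hind.comp (fun _ => centeredStat Λ f) fun _ => measurable_centeredStat Λ hf
  rw [← variance_of_integral_eq_zero (memLp_finsetSum J fun j _ => hL j).1.aemeasurable hmean,
    ← Finset.sum_fn, IndepFun.variance_sum (fun j _ => hL j)
      fun i _ j _ hij => hind'.indepFun hij,
    Finset.sum_congr rfl fun j _ => (hX j).variance_centeredStat hf hfL,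
    Finset.sum_const, nsmul_eq_mul]

variable {ι : Type*} [Fintype ι] {f : ℝ → EuclideanSpace ℝ ι} {B : ℝ}

lemma integrable_norm_sum_centeredStat_sq (hX : ∀ j, IsPoissonPath P Λ (X j))
    (hf : StronglyMeasurable f) (hB : ∀ t, ‖f t‖ ≤ B) (J : Finset ℕ) :
    Integrable (fun ω => ‖∑ j ∈ J, centeredStat Λ f (X j ω)‖ ^ 2) P := by
  have hcoord : ∀ i, StronglyMeasurable fun t => f t i := fun i => by fun_prop
  simp only [norm_sum_centeredStat_sq hf hB]
  exact integrable_finsetSum _ fun i _ => (memLp_finsetSum J fun j _ =>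
    (hX j).memLp_centeredStat (hcoord i) (.of_bound (hcoord i).aestronglyMeasurable B
      (.of_forall fun t => (PiLp.norm_apply_le (f t) i).trans (hB t)))).integrable_sq

lemma integral_norm_sum_centeredStat_sq (hX : ∀ j, IsPoissonPath P Λ (X j))
    (hind : iIndepFun X P) (hf : StronglyMeasurable f) (hB : ∀ t, ‖f t‖ ≤ B) (J : Finset ℕ) :
    ∫ ω, ‖∑ j ∈ J, centeredStat Λ f (X j ω)‖ ^ 2 ∂P = J.card * ∫ t, ‖f t‖ ^ 2 ∂Λ := by
  have hcoord : ∀ i, StronglyMeasurable fun t => f t i := fun i => by fun_prop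
  have hL : ∀ i, MemLp (fun t => f t i) 2 Λ := fun i => .of_bound (hcoord i).aestronglyMeasurable B
    (.of_forall fun t => (PiLp.norm_apply_le (f t) i).trans (hB t))
  simp only [norm_sum_centeredStat_sq hf hB, EuclideanSpace.real_norm_sq_eq]
  rw [integral_finsetSum _ fun i _ => (hL i).integrable_sq, Finset.mul_sum,
    integral_finsetSum _ fun i _ => (memLp_finsetSum J fun j _ =>
      (hX j).memLp_centeredStat (hcoord i) (hL i)).integrable_sq]
  exact Finset.sum_congr rfl fun i _ => integral_sum_centeredStat_sq hX hind (hcoord i) (hL i) J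

lemma measure_le_norm_sum_centeredStat_le (hX : ∀ j, IsPoissonPath P Λ (X j))
    (hind : iIndepFun X P) (hf : StronglyMeasurable f) (hB : ∀ t, ‖f t‖ ≤ B) (J : Finset ℕ)
    {a : ℝ} (ha : 0 < a) :
    P {ω | a ≤ ‖∑ j ∈ J, centeredStat Λ f (X j ω)‖} ≤
      ENNReal.ofReal (J.card * (B ^ 2 * Λ.real Set.univ) / a ^ 2) := by
  have hle : ∀ t, ‖‖f t‖ ^ 2‖ ≤ B ^ 2 := fun t => by
    rw [norm_pow, norm_norm]
    exact pow_le_pow_left₀ (norm_nonneg _) (hB t) 2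
  have hsq : ∫ t, ‖f t‖ ^ 2 ∂Λ ≤ B ^ 2 * Λ.real Set.univ :=
    (Real.le_norm_self _).trans (norm_integral_le_of_norm_le_const (.of_forall hle))
  refine (measure_le_norm_le (integrable_norm_sum_centeredStat_sq hX hf hB J) ha).trans
    (ENNReal.ofReal_le_ofReal ?_)
  rw [integral_norm_sum_centeredStat_sq hX hind hf hB]
  gcongr

end IsPoissonPath

/-! ### The multivariate central limit theorem -/

section CentralLimit

variable {Ω ι : Type*} [MeasurableSpace Ω] [Fintype ι] {P : Measure Ω}

lemma charFun_map_eq_charFun_map_inner {E : Type*} [NormedAddCommGroup E] [InnerProductSpace ℝ E]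
    [MeasurableSpace E] [BorelSpace E] [SecondCountableTopology E] {V : Ω → E}
    (hV : AEMeasurable V P) (u : E) :
    charFun (P.map V) u = charFun (P.map fun ω => ⟪u, V ω⟫) 1 := by
  rw [charFun_apply, charFun_apply, integral_map hV (by fun_prop),
    integral_map (by fun_prop) (by fun_prop)]
  simp [real_inner_comm]

variable [IsProbabilityMeasure P] [DecidableEq ι]

lemma tendstoInDistribution_multivariateGaussian_of_inner {V : ℕ → Ω → EuclideanSpace ℝ ι}
    (hV : ∀ n, AEMeasurable (V n) P) {S : Matrix ι ι ℝ} (hS : S.PosSemidef)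
    (hlim : ∀ u : EuclideanSpace ℝ ι, TendstoInDistribution (fun n ω => ⟪u, V n ω⟫) atTop id
      (fun _ => P) (gaussianReal 0 (u ⬝ᵥ S.mulVec u).toNNReal)) :
    TendstoInDistribution V atTop id (fun _ => P) (multivariateGaussian 0 S) := by
  refine ⟨hV, aemeasurable_id, ProbabilityMeasure.tendsto_iff_tendsto_charFun.2 fun u => ?_⟩
  have hu := ProbabilityMeasure.tendsto_iff_tendsto_charFun.1 (hlim u).tendsto 1
  have hquad : 0 ≤ u ⬝ᵥ S.mulVec u := hS.dotProduct_mulVec_nonneg u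
  simp only [ProbabilityMeasure.coe_mk, Measure.map_id] at hu ⊢
  simp only [charFun_map_eq_charFun_map_inner (hV _)]
  convert! hu using 2
  rw [charFun_gaussianReal, charFun_multivariateGaussian hS]
  simp [Real.coe_toNNReal _ hquad]

lemma tendstoInDistribution_inv_sqrt_smul_sum {V : ℕ → Ω → EuclideanSpace ℝ ι}
    (hind : iIndepFun V P) (hident : ∀ j, IdentDistrib (V j) (V 0) P P)
    (hL : ∀ u : EuclideanSpace ℝ ι, MemLp (fun ω => ⟪u, V 0 ω⟫) 2 P)
    (hmean : ∀ u : EuclideanSpace ℝ ι, ∫ ω, ⟪u, V 0 ω⟫ ∂P = 0)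
    {S : Matrix ι ι ℝ} (hS : S.PosSemidef)
    (hvar : ∀ u : EuclideanSpace ℝ ι, Var[fun ω => ⟪u, V 0 ω⟫; P] = u ⬝ᵥ S.mulVec u) :
    TendstoInDistribution (fun (n : ℕ) ω => (√n)⁻¹ • ∑ j ∈ Finset.range n, V j ω) atTop id
      (fun _ => P) (multivariateGaussian 0 S) := by
  have hV : ∀ j, AEMeasurable (V j) P := fun j => (hident j).aemeasurable_fst
  refine tendstoInDistribution_multivariateGaussian_of_inner (fun n => by fun_prop) hS fun u => ?_
  have hclt := tendstoInDistribution_inv_sqrt_mul_sum_sub (P := P) (Y := id)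
    (X := fun j ω => ⟪u, V j ω⟫) (by rw [hvar u]; exact HasLaw.id) (hL u)
    (hind.comp (fun _ v => ⟪u, v⟫) fun _ => by fun_prop)
    fun j => (hident j).comp (u := fun v => ⟪u, v⟫) (by fun_prop)
  simpa only [hmean, mul_zero, sub_zero, inner_smul_right, inner_sum] using hclt

lemma IsPoissonPath.tendstoInDistribution_sum_centeredStat {Λ : Measure ℝ} [IsFiniteMeasure Λ]
    {X : ℕ → Ω → StieltjesFunction ℝ} (hX : ∀ j, IsPoissonPath P Λ (X j)) (hind : iIndepFun X P)
    {f : ℝ → EuclideanSpace ℝ ι} (hf : StronglyMeasurable f) {B : ℝ} (hB : ∀ t, ‖f t‖ ≤ B)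
    {S : Matrix ι ι ℝ} (hS : S.PosSemidef)
    (hfS : ∀ u : EuclideanSpace ℝ ι, ∫ t, ⟪u, f t⟫ ^ 2 ∂Λ = u ⬝ᵥ S.mulVec u) :
    TendstoInDistribution
      (fun (n : ℕ) ω => (√n)⁻¹ • ∑ j ∈ Finset.range n, centeredStat Λ f (X j ω)) atTop id
      (fun _ => P) (multivariateGaussian 0 S) := by
  have hinner : ∀ u x, ⟪u, centeredStat Λ f x⟫ = centeredStat Λ (fun t => ⟪u, f t⟫) x :=
    fun u x => map_centeredStat (innerSL ℝ u) (integrable_of_stronglyMeasurable_of_bounded hf hB)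
      (integrable_of_stronglyMeasurable_of_bounded hf hB)
  have hg : ∀ u, StronglyMeasurable fun t => ⟪u, f t⟫ := fun u => by fun_prop
  have hgL : ∀ u, MemLp (fun t => ⟪u, f t⟫) 2 Λ := fun u =>
    .of_bound (hg u).aestronglyMeasurable (‖u‖ * B) (.of_forall fun t =>
      (norm_inner_le_norm _ _).trans (mul_le_mul_of_nonneg_left (hB t) (norm_nonneg u)))
  have hident : ∀ j, IdentDistrib (X j) (X 0) P P := fun j =>
    ⟨(hX j).measurable.aemeasurable, (hX 0).measurable.aemeasurable, (hX j).map_eq (hX 0)⟩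
  refine tendstoInDistribution_inv_sqrt_smul_sum
    (hind.comp (fun _ => centeredStat Λ f) fun _ => measurable_centeredStat Λ hf)
    (fun j => (hident j).comp (measurable_centeredStat Λ hf)) (fun u => ?_) (fun u => ?_) hS
    fun u => ?_
  all_goals simp only [Function.comp_apply, hinner]
  · exact (hX 0).memLp_centeredStat (hg u) (hgL u)
  · exact (hX 0).integral_centeredStat (hg u) (hgL u)
  · rw [(hX 0).variance_centeredStat (hg u) (hgL u), hfS]

end CentralLimit

/-! ### Functions with a Lipschitz gradient -/

section Gradient

variable {E : Type*} [NormedAddCommGroup E] [InnerProductSpace ℝ E] [CompleteSpace E] {s : Set E}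
  {f : E → ℝ} {g : E → E} {x y z : E}

lemma abs_sub_le_of_norm_gradient_le (hs : Convex ℝ s)
    (hf : ∀ x ∈ s, HasGradientWithinAt f (g x) s x) {C : ℝ} (hg : ∀ x ∈ s, ‖g x‖ ≤ C)
    (hx : x ∈ s) (hy : y ∈ s) : |f y - f x| ≤ C * ‖y - x‖ :=
  hs.norm_image_sub_le_of_norm_hasFDerivWithin_le
    (fun w hw => (hf w hw).hasFDerivWithinAt)
    (fun w hw => (LinearIsometryEquiv.norm_map _ _).trans_le (hg w hw)) hx hy

lemma abs_sub_sub_inner_le_of_lipschitz_gradient (hs : Convex ℝ s)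
    (hf : ∀ x ∈ s, HasGradientWithinAt f (g x) s x) {L : ℝ} (hL : 0 ≤ L)
    (hg : ∀ x ∈ s, ∀ y ∈ s, ‖g x - g y‖ ≤ L * ‖x - y‖) (hx : x ∈ s) (hy : y ∈ s) (hz : z ∈ s) :
    |f y - f x - ⟪g z, y - x⟫| ≤ L * (‖x - z‖ + ‖y - z‖) * ‖y - x‖ := by
  have hseg : segment ℝ x y ⊆ s := hs.segment_subset hx hy
  refine (convex_segment x y).norm_image_sub_le_of_norm_hasFDerivWithin_le'
    (φ := InnerProductSpace.toDual ℝ E (g z))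
    (fun w hw => (hf w (hseg hw)).hasFDerivWithinAt.mono hseg) (fun w hw => ?_)
    (left_mem_segment ℝ x y) (right_mem_segment ℝ x y)
  rw [← map_sub, LinearIsometryEquiv.norm_map]
  have hw' : ‖w - z‖ ≤ max ‖x - z‖ ‖y - z‖ := by
    simpa only [dist_eq_norm] using
      (convexOn_dist z convex_univ).le_max_of_mem_segment (Set.mem_univ x) (Set.mem_univ y) hw
  exact (hg w (hseg hw) z hz).trans (mul_le_mul_of_nonneg_left
    (hw'.trans (max_le_add_of_nonneg (norm_nonneg _) (norm_nonneg _))) hL)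

lemma measurable_of_hasGradientAt {ι α : Type*} [Fintype ι] [MeasurableSpace α]
    {F : EuclideanSpace ℝ ι → α → ℝ} {G : α → EuclideanSpace ℝ ι} {ϑ : EuclideanSpace ℝ ι}
    (hF : ∀ᶠ θ in 𝓝 ϑ, Measurable (F θ)) (hG : ∀ a, HasGradientAt (fun θ => F θ a) (G a) ϑ) :
    Measurable G := by
  classical
  suffices hcoord : ∀ i, Measurable fun a => G a i from
    (WithLp.measurable_toLp 2 (ι → ℝ)).comp (measurable_pi_lambda _ hcoord)
  intro i
  let v : EuclideanSpace ℝ ι := EuclideanSpace.single i 1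
  have hlim : Tendsto (fun n : ℕ => ϑ + (n : ℝ)⁻¹ • v) atTop (𝓝 ϑ) := by
    simpa using ((tendsto_inv_atTop_nhds_zero_nat (𝕜 := ℝ)).smul_const v).const_add ϑ
  obtain ⟨N, hN⟩ := eventually_atTop.1 (hlim.eventually hF)
  refine measurable_of_tendsto_metrizable (f := fun (n : ℕ) a =>
      ((n + N : ℕ) : ℝ) * (F (ϑ + ((n + N : ℕ) : ℝ)⁻¹ • v) a - F ϑ a))
    (fun n => ((hN _ (Nat.le_add_left N n)).sub hF.self_of_nhds).const_mul _)
    (tendsto_pi_nhds.2 fun a => ?_)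
  have h := (hG a).hasFDerivAt.lim v (c := fun n : ℕ => ((n + N : ℕ) : ℝ)) (l := atTop) <| by
    simp only [Real.norm_natCast]
    exact tendsto_natCast_atTop_atTop.comp (tendsto_add_atTop_nat N)
  simpa [v, EuclideanSpace.inner_single_right] using h

end Gradient

/-! ### Models with a Lipschitz score -/

section LipschitzScore

variable {d : ℕ} {Θ : Set (EuclideanSpace ℝ (Fin d))} {T : Set ℝ}
  {lam : EuclideanSpace ℝ (Fin d) → ℝ → ℝ} {ϑ ϑ' ϑ₀ : EuclideanSpace ℝ (Fin d)} {t : ℝ}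

/-- Regularity of the model with one derivative only: `log lam` is differentiable in `ϑ ∈ Θ`, its
gradient is bounded and Lipschitz in `ϑ`, uniformly on `Θ × T`, and the Fisher information is
nondegenerate uniformly on `Θ`. -/
structure IsLipschitzScoreModel (Θ : Set (EuclideanSpace ℝ (Fin d))) (T : Set ℝ)
    (lam : EuclideanSpace ℝ (Fin d) → ℝ → ℝ) : Prop where
  differentiableOn : ∀ t ∈ T, DifferentiableOn ℝ (fun θ => Real.log (lam θ t)) Θ
  lipschitz : ∃ C : ℝ, ∀ t ∈ T, (∀ ϑ ∈ Θ, ‖score lam ϑ t‖ ≤ C) ∧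
    ∀ ϑ ∈ Θ, ∀ ϑ' ∈ Θ, ‖score lam ϑ t - score lam ϑ' t‖ ≤ C * ‖ϑ - ϑ'‖
  nondegenerate : ∃ c : ℝ, 0 < c ∧ ∀ ϑ ∈ Θ, ∀ u : EuclideanSpace ℝ (Fin d), ‖u‖ = 1 →
    c ≤ u ⬝ᵥ (fisherInfo T lam ϑ).mulVec u

lemma IsRegularModel.isLipschitzScoreModel (hreg : IsRegularModel Θ T lam) (hΘo : IsOpen Θ)
    (hΘc : Convex ℝ Θ) : IsLipschitzScoreModel Θ T lam where
  differentiableOn t ht := (hreg.contDiff t ht).differentiableOn (by norm_num)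
  lipschitz := by
    obtain ⟨C, hC⟩ := hreg.bounded
    refine ⟨C, fun t ht => ?_⟩
    set f : EuclideanSpace ℝ (Fin d) → ℝ := fun θ => Real.log (lam θ t)
    have hscore : ∀ x, score lam x t =
        (InnerProductSpace.toDual ℝ (EuclideanSpace ℝ (Fin d))).symm (fderiv ℝ f x) := fun _ => rfl
    have hdiff : ∀ x ∈ Θ, DifferentiableAt ℝ (fderiv ℝ f) x := fun x hx =>
      (((hreg.contDiff t ht).contDiffAt (hΘo.mem_nhds hx)).fderiv_right
        (m := 1) (by norm_num)).differentiableAt (by norm_num)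
    have hbound : ∀ x ∈ Θ, ‖fderiv ℝ (fderiv ℝ f) x‖ ≤ C := fun x hx => by
      rw [← norm_iteratedFDeriv_one, norm_iteratedFDeriv_fderiv]
      exact hC x hx t ht 2 (by norm_num) (by norm_num)
    simp only [hscore, ← map_sub, LinearIsometryEquiv.norm_map]
    exact ⟨fun x hx => norm_iteratedFDeriv_one (𝕜 := ℝ) (f := f) (x := x) ▸
        hC x hx t ht 1 le_rfl (by norm_num),
      fun x hx y hy => hΘc.norm_image_sub_le_of_norm_fderiv_le hdiff hbound hy hx⟩
  nondegenerate := hreg.nondegenerate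

/-- A model with a bounded Lipschitz score on a convex open set, together with explicit constants:
`K` bounds the score, its Lipschitz constant and the ratios `lam ϑ t / lam ϑ₀ t`, and `c` is a
lower bound of the Fisher information. Keeping the constants as parameters makes all estimates
uniform in `ϑ`, which is needed since they are applied at random values of `ϑ`. -/
structure IsBoundedModel (Θ : Set (EuclideanSpace ℝ (Fin d))) (T : Set ℝ)
    (lam : EuclideanSpace ℝ (Fin d) → ℝ → ℝ) (ϑ₀ : EuclideanSpace ℝ (Fin d)) (K c : ℝ) :
    Prop where
  isOpen : IsOpen Θ
  convex : Convex ℝ Θ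
  mem : ϑ₀ ∈ Θ
  measurableSet : MeasurableSet T
  family : IsIntensityFamily Θ T lam
  hasGradientAt_log : ∀ ϑ ∈ Θ, ∀ t ∈ T,
    HasGradientAt (fun θ => Real.log (lam θ t)) (score lam ϑ t) ϑ
  nonneg : 0 ≤ K
  norm_score_le : ∀ ϑ ∈ Θ, ∀ t ∈ T, ‖score lam ϑ t‖ ≤ K
  norm_score_sub_le : ∀ ϑ ∈ Θ, ∀ ϑ' ∈ Θ, ∀ t ∈ T,
    ‖score lam ϑ t - score lam ϑ' t‖ ≤ K * ‖ϑ - ϑ'‖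
  le_mul : ∀ ϑ ∈ Θ, ∀ t ∈ T, lam ϑ t ≤ K * lam ϑ₀ t
  pos : 0 < c
  coercive : ∀ ϑ ∈ Θ, ∀ u : EuclideanSpace ℝ (Fin d), ‖u‖ = 1 →
    c ≤ u ⬝ᵥ (fisherInfo T lam ϑ).mulVec u

lemma IsLipschitzScoreModel.exists_isBoundedModel (hreg : IsLipschitzScoreModel Θ T lam)
    (hlam : IsIntensityFamily Θ T lam) (hΘo : IsOpen Θ) (hΘc : Convex ℝ Θ)
    (hΘb : Bornology.IsBounded Θ) (hT : MeasurableSet T) (hϑ₀ : ϑ₀ ∈ Θ) :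
    ∃ K c : ℝ, IsBoundedModel Θ T lam ϑ₀ K c := by
  obtain ⟨C, hC⟩ := hreg.lipschitz
  obtain ⟨c, hc, hcoer⟩ := hreg.nondegenerate
  obtain ⟨D, hD⟩ := Metric.isBounded_iff.1 hΘb
  have hgrad : ∀ ϑ ∈ Θ, ∀ t ∈ T,
      HasGradientAt (fun θ => Real.log (lam θ t)) (score lam ϑ t) ϑ := fun ϑ hϑ t ht =>
    ((hreg.differentiableOn t ht).differentiableAt (hΘo.mem_nhds hϑ)).hasGradientAt
  have hratio : ∀ ϑ ∈ Θ, ∀ t ∈ T, lam ϑ t ≤ Real.exp (C * D) * lam ϑ₀ t := fun ϑ hϑ t ht => by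
    have hC0 : 0 ≤ C := (norm_nonneg _).trans ((hC t ht).1 ϑ hϑ)
    have hlog := abs_sub_le_of_norm_gradient_le hΘc
      (fun x hx => (hgrad x hx t ht).hasFDerivAt.hasFDerivWithinAt) (hC t ht).1 hϑ₀ hϑ
    rw [← dist_eq_norm] at hlog
    have hexp : Real.log (lam ϑ t) ≤ C * D + Real.log (lam ϑ₀ t) := by
      linarith [(abs_le.1 hlog).2, mul_le_mul_of_nonneg_left (hD hϑ hϑ₀) hC0]
    simpa only [Real.exp_add, Real.exp_log (hlam.pos _ hϑ t ht),
      Real.exp_log (hlam.pos _ hϑ₀ t ht)] using Real.exp_le_exp.2 hexp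
  exact ⟨max C (Real.exp (C * D)), c, hΘo, hΘc, hϑ₀, hT, hlam, hgrad,
    (Real.exp_pos _).le.trans (le_max_right _ _),
    fun ϑ hϑ t ht => ((hC t ht).1 ϑ hϑ).trans (le_max_left _ _),
    fun ϑ hϑ ϑ' hϑ' t ht => ((hC t ht).2 ϑ hϑ ϑ' hϑ').trans
      (mul_le_mul_of_nonneg_right (le_max_left _ _) (norm_nonneg _)),
    fun ϑ hϑ t ht => (hratio ϑ hϑ t ht).trans
      (mul_le_mul_of_nonneg_right (le_max_right _ _) (hlam.pos _ hϑ₀ t ht).le),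
    hc, hcoer⟩

namespace IsBoundedModel

variable {K c : ℝ} (hM : IsBoundedModel Θ T lam ϑ₀ K c)
include hM

lemma lam_nonneg (hϑ : ϑ ∈ Θ) (ht : t ∈ T) : 0 ≤ lam ϑ t :=
  (hM.family.pos ϑ hϑ t ht).le

lemma hasGradientAt_lam (hϑ : ϑ ∈ Θ) (ht : t ∈ T) :
    HasGradientAt (fun θ => lam θ t) (lam ϑ t • score lam ϑ t) ϑ := by
  have h := (hM.hasGradientAt_log ϑ hϑ t ht).hasFDerivAt.exp
  rw [Real.exp_log (hM.family.pos ϑ hϑ t ht)] at h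
  rw [hasGradientAt_iff_hasFDerivAt, map_smul]
  refine h.congr_of_eventuallyEq ?_
  filter_upwards [hM.isOpen.mem_nhds hϑ] with θ hθ using
    (Real.exp_log (hM.family.pos θ hθ t ht)).symm

lemma norm_lam_smul_score_le (hϑ : ϑ ∈ Θ) (hϑ' : ϑ' ∈ Θ) (ht : t ∈ T) :
    ‖lam ϑ t • score lam ϑ' t‖ ≤ K ^ 2 * lam ϑ₀ t := by
  rw [norm_smul, Real.norm_of_nonneg (hM.lam_nonneg hϑ ht)]
  calc lam ϑ t * ‖score lam ϑ' t‖ ≤ (K * lam ϑ₀ t) * K :=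
        mul_le_mul (hM.le_mul ϑ hϑ t ht) (hM.norm_score_le ϑ' hϑ' t ht) (norm_nonneg _)
          (mul_nonneg hM.nonneg (hM.lam_nonneg hM.mem ht))
    _ = K ^ 2 * lam ϑ₀ t := by ring

lemma abs_lam_sub_le (hϑ : ϑ ∈ Θ) (hϑ' : ϑ' ∈ Θ) (ht : t ∈ T) :
    |lam ϑ t - lam ϑ' t| ≤ K ^ 2 * lam ϑ₀ t * ‖ϑ - ϑ'‖ :=
  abs_sub_le_of_norm_gradient_le hM.convex
    (fun _ hx => (hM.hasGradientAt_lam hx ht).hasFDerivAt.hasFDerivWithinAt)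
    (fun _ hx => hM.norm_lam_smul_score_le hx hx ht) hϑ' hϑ

lemma norm_lam_smul_score_sub_le (hϑ : ϑ ∈ Θ) (hϑ' : ϑ' ∈ Θ) (ht : t ∈ T) :
    ‖lam ϑ t • score lam ϑ t - lam ϑ' t • score lam ϑ' t‖ ≤
      (K ^ 3 + K ^ 2) * lam ϑ₀ t * ‖ϑ - ϑ'‖ := by
  have hK := hM.nonneg
  have hp := hM.lam_nonneg hM.mem ht
  have hsplit : lam ϑ t • score lam ϑ t - lam ϑ' t • score lam ϑ' t =
      (lam ϑ t - lam ϑ' t) • score lam ϑ t + lam ϑ' t • (score lam ϑ t - score lam ϑ' t) := by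
    module
  calc _ ≤ |lam ϑ t - lam ϑ' t| * ‖score lam ϑ t‖ +
        lam ϑ' t * ‖score lam ϑ t - score lam ϑ' t‖ := by
        rw [hsplit]
        refine (norm_add_le _ _).trans_eq ?_
        rw [norm_smul, norm_smul, Real.norm_eq_abs, Real.norm_of_nonneg (hM.lam_nonneg hϑ' ht)]
    _ ≤ (K ^ 2 * lam ϑ₀ t * ‖ϑ - ϑ'‖) * K + (K * lam ϑ₀ t) * (K * ‖ϑ - ϑ'‖) := by
        gcongr
        · exact hM.abs_lam_sub_le hϑ hϑ' ht
        · exact hM.norm_score_le ϑ hϑ t ht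
        · exact hM.le_mul ϑ' hϑ' t ht
        · exact hM.norm_score_sub_le ϑ hϑ ϑ' hϑ' t ht
    _ = _ := by ring

lemma abs_lam_sub_sub_inner_le {ϑ₁ ϑ₂ : EuclideanSpace ℝ (Fin d)} (hϑ : ϑ ∈ Θ) (h₁ : ϑ₁ ∈ Θ)
    (h₂ : ϑ₂ ∈ Θ) (ht : t ∈ T) :
    |lam ϑ₁ t - lam ϑ₂ t - ⟪lam ϑ t • score lam ϑ t, ϑ₁ - ϑ₂⟫| ≤
      (K ^ 3 + K ^ 2) * lam ϑ₀ t * (‖ϑ₂ - ϑ‖ + ‖ϑ₁ - ϑ‖) * ‖ϑ₁ - ϑ₂‖ := by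
  have hK := hM.nonneg
  have hp := hM.lam_nonneg hM.mem ht
  exact abs_sub_sub_inner_le_of_lipschitz_gradient hM.convex
    (fun x hx => (hM.hasGradientAt_lam hx ht).hasFDerivAt.hasFDerivWithinAt) (by positivity)
    (fun x hx y hy => hM.norm_lam_smul_score_sub_le hx hy ht) h₂ h₁ hϑ

lemma measurable_score (hϑ : ϑ ∈ Θ) : Measurable fun t : T => score lam ϑ t :=
  measurable_of_hasGradientAt (F := fun θ (t : T) => Real.log (lam θ t))
    (by filter_upwards [hM.isOpen.mem_nhds hϑ] with θ hθ using (hM.family.measurable θ hθ).log)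
    fun t => hM.hasGradientAt_log ϑ hϑ t t.2

lemma aestronglyMeasurable_score {μ : Measure ℝ} (hϑ : ϑ ∈ Θ) :
    AEStronglyMeasurable (score lam ϑ) (μ.restrict T) :=
  (aemeasurable_restrict_of_measurable_subtype hM.measurableSet
    (hM.measurable_score hϑ)).aestronglyMeasurable

lemma integrableOn_of_norm_le {F : Type*} [NormedAddCommGroup F] {f : ℝ → F}
    (hf : AEStronglyMeasurable f (volume.restrict T)) {C : ℝ}
    (hC : ∀ t ∈ T, ‖f t‖ ≤ C * lam ϑ₀ t) : IntegrableOn f T :=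
  ((hM.family.integrable ϑ₀ hM.mem).const_mul C).mono' hf
    ((ae_restrict_iff' hM.measurableSet).2 (.of_forall hC))

lemma norm_setIntegral_le {F : Type*} [NormedAddCommGroup F] [NormedSpace ℝ F] {f : ℝ → F}
    {C : ℝ} (hC : ∀ t ∈ T, ‖f t‖ ≤ C * lam ϑ₀ t) :
    ‖∫ t in T, f t‖ ≤ C * ∫ t in T, lam ϑ₀ t := by
  rw [← integral_const_mul]
  exact norm_integral_le_of_norm_le ((hM.family.integrable ϑ₀ hM.mem).const_mul C)
    ((ae_restrict_iff' hM.measurableSet).2 (.of_forall hC))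

lemma integral_lam_nonneg : 0 ≤ ∫ t in T, lam ϑ₀ t :=
  setIntegral_nonneg hM.measurableSet fun _ ht => hM.lam_nonneg hM.mem ht

lemma integrableOn_lam_smul_score (hϑ : ϑ ∈ Θ) (hϑ' : ϑ' ∈ Θ) :
    IntegrableOn (fun t => lam ϑ t • score lam ϑ' t) T :=
  hM.integrableOn_of_norm_le
    ((hM.family.integrable ϑ hϑ).1.smul (hM.aestronglyMeasurable_score hϑ'))
    fun _ ht => hM.norm_lam_smul_score_le hϑ hϑ' ht

end IsBoundedModel

end LipschitzScore

/-! ### The Fisher information as an operator -/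

section Fisher

variable {d : ℕ} {Θ : Set (EuclideanSpace ℝ (Fin d))} {T : Set ℝ}
  {lam : EuclideanSpace ℝ (Fin d) → ℝ → ℝ} {ϑ ϑ' ϑ₀ ϑ₁ ϑ₂ : EuclideanSpace ℝ (Fin d)} {K c : ℝ}

/-- The Fisher information as an operator on the Euclidean space. -/
noncomputable def fisherOp (T : Set ℝ) (lam : EuclideanSpace ℝ (Fin d) → ℝ → ℝ)
    (ϑ : EuclideanSpace ℝ (Fin d)) : EuclideanSpace ℝ (Fin d) →L[ℝ] EuclideanSpace ℝ (Fin d) :=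
  Matrix.toEuclideanCLM (𝕜 := ℝ) (fisherInfo T lam ϑ)

/-- The inverse Fisher information as an operator on the Euclidean space. -/
noncomputable def fisherInvOp (T : Set ℝ) (lam : EuclideanSpace ℝ (Fin d) → ℝ → ℝ)
    (ϑ : EuclideanSpace ℝ (Fin d)) : EuclideanSpace ℝ (Fin d) →L[ℝ] EuclideanSpace ℝ (Fin d) :=
  Matrix.toEuclideanCLM (𝕜 := ℝ) (fisherInfo T lam ϑ)⁻¹

lemma isHermitian_fisherInfo (T : Set ℝ) (lam : EuclideanSpace ℝ (Fin d) → ℝ → ℝ)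
    (ϑ : EuclideanSpace ℝ (Fin d)) : (fisherInfo T lam ϑ).IsHermitian := by
  ext i j
  simp only [fisherInfo, Matrix.conjTranspose_apply, Matrix.of_apply, star_trivial, mul_comm]

lemma inner_fisherInvOp_comm (T : Set ℝ) (lam : EuclideanSpace ℝ (Fin d) → ℝ → ℝ)
    (ϑ u v : EuclideanSpace ℝ (Fin d)) :
    ⟪u, fisherInvOp T lam ϑ v⟫ = ⟪fisherInvOp T lam ϑ u, v⟫ :=
  (Matrix.isSymmetric_toEuclideanLin_iff.2 (isHermitian_fisherInfo T lam ϑ).inv u v).symm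

namespace IsBoundedModel

variable (hM : IsBoundedModel Θ T lam ϑ₀ K c)
include hM

lemma integrableOn_inner_smul (hϑ : ϑ ∈ Θ) (u : EuclideanSpace ℝ (Fin d)) :
    IntegrableOn (fun t => ⟪score lam ϑ t, u⟫ • lam ϑ t • score lam ϑ t) T := by
  have hK := hM.nonneg
  refine hM.integrableOn_of_norm_le (C := K * ‖u‖ * K ^ 2)
    (((hM.aestronglyMeasurable_score hϑ).inner (𝕜 := ℝ) aestronglyMeasurable_const).smul
      (hM.integrableOn_lam_smul_score hϑ hϑ).1) fun t ht => ?_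
  rw [norm_smul, mul_assoc]
  gcongr
  · exact (norm_inner_le_norm _ _).trans (by gcongr; exact hM.norm_score_le ϑ hϑ t ht)
  · exact hM.norm_lam_smul_score_le hϑ hϑ ht

lemma fisherInfo_apply (hϑ : ϑ ∈ Θ) (l k : Fin d) :
    fisherInfo T lam ϑ l k = ∫ t in T, score lam ϑ t k * (lam ϑ t * score lam ϑ t l) := by
  refine setIntegral_congr_fun hM.measurableSet fun t ht => ?_
  have := (hM.family.pos ϑ hϑ t ht).ne'
  simp only [(hM.hasGradientAt_lam hϑ ht).gradient, PiLp.smul_apply, smul_eq_mul]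
  field_simp

lemma fisherOp_apply (hϑ : ϑ ∈ Θ) (u : EuclideanSpace ℝ (Fin d)) :
    fisherOp T lam ϑ u = ∫ t in T, ⟪score lam ϑ t, u⟫ • lam ϑ t • score lam ϑ t := by
  have hcoord : ∀ l v, IntegrableOn
        (fun t => ⟪score lam ϑ t, v⟫ * (lam ϑ t * score lam ϑ t l)) T ∧
      (∫ t in T, ⟪score lam ϑ t, v⟫ • lam ϑ t • score lam ϑ t) l =
        ∫ t in T, ⟪score lam ϑ t, v⟫ * (lam ϑ t * score lam ϑ t l) := fun l v =>
    let π : EuclideanSpace ℝ (Fin d) →L[ℝ] ℝ := EuclideanSpace.proj l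
    ⟨π.integrable_comp (hM.integrableOn_inner_smul hϑ v),
      (π.integral_comp_comm (hM.integrableOn_inner_smul hϑ v)).symm⟩
  have hintegrable : ∀ l k, IntegrableOn
      (fun t => score lam ϑ t k * (lam ϑ t * score lam ϑ t l)) T :=
    fun l k => by simpa [EuclideanSpace.inner_single_right] using
      (hcoord l (EuclideanSpace.single k 1)).1
  ext l
  rw [(hcoord l u).2, fisherOp, Matrix.ofLp_toEuclideanCLM, Matrix.mulVec, dotProduct]
  simp only [hM.fisherInfo_apply hϑ, ← integral_mul_const]
  rw [← integral_finsetSum _ fun k _ => (hintegrable l k).mul_const (u k)]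
  refine integral_congr_ae (.of_forall fun t => ?_)
  simp only [PiLp.inner_apply, RCLike.inner_apply, conj_trivial, Finset.sum_mul]
  exact Finset.sum_congr rfl fun k _ => by ring

lemma norm_fisherOp_sub_le (hϑ : ϑ ∈ Θ) (hϑ' : ϑ' ∈ Θ) :
    ‖fisherOp T lam ϑ - fisherOp T lam ϑ'‖ ≤
      ((K ^ 4 + 2 * K ^ 3) * ∫ t in T, lam ϑ₀ t) * ‖ϑ - ϑ'‖ := by
  have hK := hM.nonneg
  have hL := hM.integral_lam_nonneg
  refine ContinuousLinearMap.opNorm_le_bound _ (by positivity) fun u => ?_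
  rw [sub_apply, hM.fisherOp_apply hϑ, hM.fisherOp_apply hϑ',
    ← integral_sub (hM.integrableOn_inner_smul hϑ u) (hM.integrableOn_inner_smul hϑ' u)]
  refine (hM.norm_setIntegral_le (C := (K ^ 4 + 2 * K ^ 3) * ‖ϑ - ϑ'‖ * ‖u‖)
    fun t ht => ?_).trans_eq (by ring)
  set s := score lam ϑ t
  set s' := score lam ϑ' t
  have hp := hM.lam_nonneg hM.mem ht
  have hsplit : ⟪s, u⟫ • lam ϑ t • s - ⟪s', u⟫ • lam ϑ' t • s' =
      ⟪s - s', u⟫ • lam ϑ t • s + ⟪s', u⟫ • (lam ϑ t • s - lam ϑ' t • s') := by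
    rw [inner_sub_left]; module
  calc _ ≤ ‖s - s'‖ * ‖u‖ * ‖lam ϑ t • s‖ + ‖s'‖ * ‖u‖ * ‖lam ϑ t • s - lam ϑ' t • s'‖ := by
        rw [hsplit]
        refine (norm_add_le _ _).trans ?_
        rw [norm_smul, norm_smul _ (lam ϑ t • s - lam ϑ' t • s')]
        exact add_le_add
          (mul_le_mul_of_nonneg_right (norm_inner_le_norm _ _) (norm_nonneg _))
          (mul_le_mul_of_nonneg_right (norm_inner_le_norm _ _) (norm_nonneg _))
    _ ≤ (K * ‖ϑ - ϑ'‖) * ‖u‖ * (K ^ 2 * lam ϑ₀ t) +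
        K * ‖u‖ * ((K ^ 3 + K ^ 2) * lam ϑ₀ t * ‖ϑ - ϑ'‖) := by
        gcongr
        · exact hM.norm_score_sub_le ϑ hϑ ϑ' hϑ' t ht
        · exact hM.norm_lam_smul_score_le hϑ hϑ ht
        · exact hM.norm_score_le ϑ' hϑ' t ht
        · exact hM.norm_lam_smul_score_sub_le hϑ hϑ' ht
    _ = _ := by ring

lemma norm_integral_sub_fisherOp_le (hϑ : ϑ ∈ Θ) (h₁ : ϑ₁ ∈ Θ) (h₂ : ϑ₂ ∈ Θ) :
    ‖(∫ t in T, (lam ϑ₁ t - lam ϑ₂ t) • score lam ϑ t) - fisherOp T lam ϑ (ϑ₁ - ϑ₂)‖ ≤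
      ((K ^ 4 + K ^ 3) * ∫ t in T, lam ϑ₀ t) * (‖ϑ₂ - ϑ‖ + ‖ϑ₁ - ϑ‖) * ‖ϑ₁ - ϑ₂‖ := by
  have hK := hM.nonneg
  have hintegrable : IntegrableOn (fun t => (lam ϑ₁ t - lam ϑ₂ t) • score lam ϑ t) T := by
    simp only [sub_smul]
    exact (hM.integrableOn_lam_smul_score h₁ hϑ).sub (hM.integrableOn_lam_smul_score h₂ hϑ)
  rw [hM.fisherOp_apply hϑ, ← integral_sub hintegrable (hM.integrableOn_inner_smul hϑ _)]
  refine (hM.norm_setIntegral_le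
    (C := (K ^ 4 + K ^ 3) * (‖ϑ₂ - ϑ‖ + ‖ϑ₁ - ϑ‖) * ‖ϑ₁ - ϑ₂‖) fun t ht => ?_).trans_eq (by ring)
  have hp := hM.lam_nonneg hM.mem ht
  have hfactor : (lam ϑ₁ t - lam ϑ₂ t) • score lam ϑ t -
      ⟪score lam ϑ t, ϑ₁ - ϑ₂⟫ • lam ϑ t • score lam ϑ t =
      (lam ϑ₁ t - lam ϑ₂ t - ⟪lam ϑ t • score lam ϑ t, ϑ₁ - ϑ₂⟫) • score lam ϑ t := by
    rw [real_inner_smul_left]; module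
  calc _ ≤ ((K ^ 3 + K ^ 2) * lam ϑ₀ t * (‖ϑ₂ - ϑ‖ + ‖ϑ₁ - ϑ‖) * ‖ϑ₁ - ϑ₂‖) * K := by
        rw [hfactor, norm_smul]
        gcongr
        · exact hM.abs_lam_sub_sub_inner_le hϑ h₁ h₂ ht
        · exact hM.norm_score_le ϑ hϑ t ht
    _ = _ := by ring

lemma le_inner_fisherOp (hϑ : ϑ ∈ Θ) (u : EuclideanSpace ℝ (Fin d)) :
    c * ‖u‖ ^ 2 ≤ ⟪u, fisherOp T lam ϑ u⟫ := by
  rcases eq_or_ne u 0 with rfl | hu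
  · simp only [map_zero, inner_zero_right, norm_zero, ne_eq, OfNat.ofNat_ne_zero,
      not_false_eq_true, zero_pow, mul_zero, le_refl]
  have hu' : ‖u‖ ≠ 0 := norm_ne_zero_iff.2 hu
  have hunit : c ≤ ⟪‖u‖⁻¹ • u, fisherOp T lam ϑ (‖u‖⁻¹ • u)⟫ := by
    rw [fisherOp, Matrix.inner_toEuclideanCLM]
    exact hM.coercive ϑ hϑ _ (by rw [norm_smul, norm_inv, norm_norm, inv_mul_cancel₀ hu'])
  rw [map_smul, real_inner_smul_left, real_inner_smul_right] at hunit
  calc c * ‖u‖ ^ 2 ≤ (‖u‖⁻¹ * (‖u‖⁻¹ * ⟪u, fisherOp T lam ϑ u⟫)) * ‖u‖ ^ 2 := by gcongr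
    _ = _ := by field_simp

lemma posDef_fisherInfo (hϑ : ϑ ∈ Θ) : (fisherInfo T lam ϑ).PosDef := by
  refine .of_dotProduct_mulVec_pos (isHermitian_fisherInfo T lam ϑ) fun x hx => ?_
  have hnorm : 0 < ‖WithLp.toLp 2 x‖ := norm_pos_iff.2 ((WithLp.toLp_eq_zero 2).not.2 hx)
  have hle := hM.le_inner_fisherOp hϑ (WithLp.toLp 2 x)
  rw [fisherOp, Matrix.inner_toEuclideanCLM] at hle
  exact (mul_pos hM.pos (pow_pos hnorm 2)).trans_le hle

lemma isUnit_det_fisherInfo (hϑ : ϑ ∈ Θ) : IsUnit (fisherInfo T lam ϑ).det :=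
  (hM.posDef_fisherInfo hϑ).det_pos.ne'.isUnit

lemma fisherInvOp_fisherOp (hϑ : ϑ ∈ Θ) (u : EuclideanSpace ℝ (Fin d)) :
    fisherInvOp T lam ϑ (fisherOp T lam ϑ u) = u := by
  rw [← mul_apply_eq_comp, fisherInvOp, fisherOp, ← map_mul,
    Matrix.nonsing_inv_mul _ (hM.isUnit_det_fisherInfo hϑ), map_one,
    one_apply_eq_self]

lemma fisherOp_fisherInvOp (hϑ : ϑ ∈ Θ) (u : EuclideanSpace ℝ (Fin d)) :
    fisherOp T lam ϑ (fisherInvOp T lam ϑ u) = u := by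
  rw [← mul_apply_eq_comp, fisherInvOp, fisherOp, ← map_mul,
    Matrix.mul_nonsing_inv _ (hM.isUnit_det_fisherInfo hϑ), map_one,
    one_apply_eq_self]

lemma norm_fisherInvOp_le (hϑ : ϑ ∈ Θ) : ‖fisherInvOp T lam ϑ‖ ≤ c⁻¹ := by
  refine ContinuousLinearMap.opNorm_le_bound _ (inv_nonneg.2 hM.pos.le) fun u => ?_
  set w := fisherInvOp T lam ϑ u with hw
  have hle : c * ‖w‖ ^ 2 ≤ ‖w‖ * ‖u‖ := by
    have h := hM.le_inner_fisherOp hϑ w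
    rw [hw, hM.fisherOp_fisherInvOp hϑ, ← hw] at h
    exact h.trans (real_inner_le_norm w u)
  rw [← div_eq_inv_mul, le_div_iff₀ hM.pos]
  rcases (norm_nonneg w).eq_or_lt with h0 | h0
  · rw [← h0, zero_mul]; exact norm_nonneg u
  · nlinarith

lemma norm_fisherInvOp_sub_le (hϑ : ϑ ∈ Θ) (hϑ' : ϑ' ∈ Θ) :
    ‖fisherInvOp T lam ϑ - fisherInvOp T lam ϑ'‖ ≤
      (c⁻¹ ^ 2 * ((K ^ 4 + 2 * K ^ 3) * ∫ t in T, lam ϑ₀ t)) * ‖ϑ - ϑ'‖ := by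
  have hc := inv_nonneg.2 hM.pos.le
  have hsplit : fisherInvOp T lam ϑ - fisherInvOp T lam ϑ' = fisherInvOp T lam ϑ *
      (fisherOp T lam ϑ' - fisherOp T lam ϑ) * fisherInvOp T lam ϑ' := by
    ext1 u
    simp only [mul_apply_eq_comp, sub_apply, map_sub,
      hM.fisherInvOp_fisherOp hϑ, hM.fisherOp_fisherInvOp hϑ']
  calc _ ≤ c⁻¹ * (((K ^ 4 + 2 * K ^ 3) * ∫ t in T, lam ϑ₀ t) * ‖ϑ' - ϑ‖) * c⁻¹ := by
        rw [hsplit]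
        refine (norm_mul_le _ _).trans (mul_le_mul ((norm_mul_le _ _).trans ?_)
          (hM.norm_fisherInvOp_le hϑ') (norm_nonneg _) ?_)
        · gcongr
          · exact hM.norm_fisherInvOp_le hϑ
          · exact hM.norm_fisherOp_sub_le hϑ' hϑ
        · have := hM.nonneg; have := hM.integral_lam_nonneg; positivity
    _ = _ := by rw [norm_sub_rev]; ring

end IsBoundedModel

end Fisher

/-! ### Independence of the preliminary estimate and the later observations -/

section Decoupling

variable {Ω : Type*} [MeasurableSpace Ω] {P : Measure Ω}

lemma measure_le_of_indepFun {α β : Type*} [MeasurableSpace α] [MeasurableSpace β]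
    [IsProbabilityMeasure P] {Y : Ω → α} {W : Ω → β} (hY : Measurable Y) (hW : Measurable W)
    (hYW : IndepFun Y W P) {A : Set (α × β)} (hA : MeasurableSet A) {η : ℝ≥0∞}
    (h : ∀ y, P {ω | (y, W ω) ∈ A} ≤ η) : P {ω | (Y ω, W ω) ∈ A} ≤ η := by
  have hmap := (indepFun_iff_map_prod_eq_prod_map_map hY.aemeasurable hW.aemeasurable).1 hYW
  have : IsProbabilityMeasure (P.map Y) := Measure.isProbabilityMeasure_map hY.aemeasurable
  have : IsProbabilityMeasure (P.map W) := Measure.isProbabilityMeasure_map hW.aemeasurable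
  calc P {ω | (Y ω, W ω) ∈ A} = (P.map fun ω => (Y ω, W ω)) A :=
        (Measure.map_apply (hY.prodMk hW) hA).symm
    _ = ∫⁻ y, P.map W (Prod.mk y ⁻¹' A) ∂(P.map Y) := by rw [hmap, Measure.prod_apply hA]
    _ ≤ ∫⁻ _, η ∂(P.map Y) := lintegral_mono fun y => by
        rw [Measure.map_apply hW (measurable_prodMk_left hA)]
        exact h y
    _ = η := by rw [lintegral_const, measure_univ, mul_one]

lemma iIndepFun_of_paths {X : ℕ → Ω → StieltjesFunction ℝ}
    (h : iIndepFun (fun (j : ℕ) (ω : Ω) (t : ℝ) => X j ω t) P) : iIndepFun X P := by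
  rw [iIndepFun_iff] at h ⊢
  intro s f' hf'
  refine h s fun i hi => ?_
  have hfi := hf' i hi
  rwa [pathMeasurableSpace, MeasurableSpace.comap_comp] at hfi

lemma observedSigma_le {X : ℕ → Ω → StieltjesFunction ℝ} (hX : ∀ j, Measurable (X j)) (N : ℕ) :
    observedSigma X N ≤ ‹MeasurableSpace Ω› :=
  iSup₂_le fun j _ => iSup_le fun t => ((measurable_path_eval t).comp (hX j)).comap_le

lemma indepFun_of_measurable_observedSigma {X : ℕ → Ω → StieltjesFunction ℝ}
    (hX : ∀ j, Measurable (X j)) (hind : iIndepFun X P)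
    {β : Type*} [MeasurableSpace β] {N : ℕ} {Y : Ω → β} (hY : Measurable[observedSigma X N] Y)
    {J : Finset ℕ} (hJ : Disjoint (Finset.range N) J) :
    IndepFun Y (fun ω (j : J) => X j ω) P := by
  have h := hind.indepFun_finset (Finset.range N) J hJ hX
  rw [IndepFun_iff_Indep] at h ⊢
  refine indep_of_indep_of_le_left h (hY.comap_le.trans ?_)
  refine iSup₂_le fun j hj => iSup_le fun t => ?_
  exact (((measurable_path_eval t).comp (measurable_pi_apply (⟨j, hj⟩ : Finset.range N))).comp
    (comap_measurable fun ω (i : Finset.range N) => X i ω)).comap_le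

end Decoupling

/-! ### The score statistic -/

lemma measurable_indicator_of_subtype {α β : Type*} [MeasurableSpace α] [MeasurableSpace β]
    [Zero β] {s : Set α} (hs : MeasurableSet s) {f : α → β} (hf : Measurable fun x : s => f x) :
    Measurable (s.indicator f) := by
  refine measurable_of_restrict_of_restrict_compl hs ?_ ?_
  · have hrestrict : s.domRestrict (s.indicator f) = fun x : s => f x :=
      funext fun x => Set.indicator_of_mem x.2 f
    rwa [hrestrict]
  · have hrestrict : sᶜ.domRestrict (s.indicator f) = fun _ => 0 :=
      funext fun x => Set.indicator_of_notMem x.2 f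
    rw [hrestrict]
    exact measurable_const

section ScoreStat

variable {d : ℕ} {Θ : Set (EuclideanSpace ℝ (Fin d))} {T : Set ℝ}
  {lam : EuclideanSpace ℝ (Fin d) → ℝ → ℝ} {ϑ ϑ' ϑ₀ : EuclideanSpace ℝ (Fin d)} {K c : ℝ}

/-- `scoreIntegral` with the jump measure of the path. The two agree on paths of finite total
variation, that is almost surely, but this version is measurable on the whole path space. -/
noncomputable def scoreStat (T : Set ℝ) (lam : EuclideanSpace ℝ (Fin d) → ℝ → ℝ)
    (ϑ ϑ' : EuclideanSpace ℝ (Fin d)) (x : StieltjesFunction ℝ) : EuclideanSpace ℝ (Fin d) :=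
  (∫ t in T, score lam ϑ t ∂(jumpMeasure x)) - ∫ t in T, lam ϑ' t • score lam ϑ t

lemma scoringCorrection_eq_fisherInvOp (hϑ : ϑ ∈ Θ) (hϑ' : ϑ' ∈ Θ)
    {x : ℕ → StieltjesFunction ℝ} (hx : ∀ j, (x j).measure Set.univ < ∞) (N k : ℕ) :
    scoringCorrection Θ T lam N k x ϑ ϑ' = fisherInvOp T lam ϑ
      ((1 / (k : ℝ)) • ∑ j ∈ Finset.Ico N k, scoreStat T lam ϑ ϑ' (x j)) := by
  simp only [scoringCorrection, if_pos (And.intro hϑ hϑ'), fisherInvOp, scoreIntegral, scoreStat,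
    jumpMeasure_of_lt_top (hx _)]

namespace IsBoundedModel

variable (hM : IsBoundedModel Θ T lam ϑ₀ K c)
include hM

lemma isFiniteMeasure_intensityMeasure : IsFiniteMeasure (intensityMeasure T (lam ϑ₀)) :=
  _root_.isFiniteMeasure_intensityMeasure (hM.family.integrable ϑ₀ hM.mem)

lemma measurable_indicator_score (hϑ : ϑ ∈ Θ) : Measurable (T.indicator (score lam ϑ)) :=
  measurable_indicator_of_subtype hM.measurableSet (hM.measurable_score hϑ)

lemma norm_indicator_score_le (hϑ : ϑ ∈ Θ) (t : ℝ) : ‖T.indicator (score lam ϑ) t‖ ≤ K := by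
  by_cases ht : t ∈ T
  · rw [Set.indicator_of_mem ht]
    exact hM.norm_score_le ϑ hϑ t ht
  · rw [Set.indicator_of_notMem ht, norm_zero]
    exact hM.nonneg

lemma integrable_indicator_score {μ : Measure ℝ} [IsFiniteMeasure μ] (hϑ : ϑ ∈ Θ) :
    Integrable (T.indicator (score lam ϑ)) μ :=
  integrable_of_stronglyMeasurable_of_bounded (hM.measurable_indicator_score hϑ).stronglyMeasurable
    (hM.norm_indicator_score_le hϑ)

lemma norm_indicator_score_sub_le (hϑ : ϑ ∈ Θ) (hϑ' : ϑ' ∈ Θ) (t : ℝ) :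
    ‖T.indicator (score lam ϑ) t - T.indicator (score lam ϑ') t‖ ≤ K * ‖ϑ - ϑ'‖ := by
  by_cases ht : t ∈ T
  · rw [Set.indicator_of_mem ht, Set.indicator_of_mem ht]
    exact hM.norm_score_sub_le ϑ hϑ ϑ' hϑ' t ht
  · rw [Set.indicator_of_notMem ht, Set.indicator_of_notMem ht, sub_self, norm_zero]
    exact mul_nonneg hM.nonneg (norm_nonneg _)

lemma scoreStat_eq_centeredStat (ϑ : EuclideanSpace ℝ (Fin d)) (x : StieltjesFunction ℝ) :
    scoreStat T lam ϑ ϑ₀ x =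
      centeredStat (intensityMeasure T (lam ϑ₀)) (T.indicator (score lam ϑ)) x := by
  rw [scoreStat, centeredStat, integral_indicator hM.measurableSet,
    integral_intensityMeasure hM.measurableSet (hM.family.integrable ϑ₀ hM.mem)
      fun t ht => hM.lam_nonneg hM.mem ht]
  refine congrArg _ (setIntegral_congr_fun hM.measurableSet fun t ht => ?_)
  simp only [Set.indicator_of_mem ht]

lemma scoreStat_sub_scoreStat_left (hϑ : ϑ ∈ Θ) (hϑ' : ϑ' ∈ Θ) (x : StieltjesFunction ℝ) :
    scoreStat T lam ϑ ϑ₀ x - scoreStat T lam ϑ' ϑ₀ x =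
      centeredStat (intensityMeasure T (lam ϑ₀))
        (fun t => T.indicator (score lam ϑ) t - T.indicator (score lam ϑ') t) x := by
  have := hM.isFiniteMeasure_intensityMeasure
  rw [hM.scoreStat_eq_centeredStat, hM.scoreStat_eq_centeredStat]
  exact centeredStat_sub (hM.integrable_indicator_score hϑ) (hM.integrable_indicator_score hϑ')
    (hM.integrable_indicator_score hϑ) (hM.integrable_indicator_score hϑ')

lemma scoreStat_sub_scoreStat_right (hϑ : ϑ ∈ Θ) (hϑ' : ϑ' ∈ Θ) (x : StieltjesFunction ℝ) :
    scoreStat T lam ϑ ϑ₀ x - scoreStat T lam ϑ ϑ' x =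
      ∫ t in T, (lam ϑ' t - lam ϑ₀ t) • score lam ϑ t := by
  simp only [scoreStat, sub_smul, sub_sub_sub_cancel_left]
  exact (integral_sub (hM.integrableOn_lam_smul_score hϑ' hϑ)
    (hM.integrableOn_lam_smul_score hM.mem hϑ)).symm

lemma continuous_scoreStat (x : StieltjesFunction ℝ) :
    Continuous fun p : Θ × Θ => scoreStat T lam p.1 p.2 x := by
  have hscore : ∀ t ∈ T, Continuous fun ϑ : Θ => score lam ϑ t := fun t ht =>
    (LipschitzWith.of_dist_le' (K := K) fun ϑ ϑ' : Θ => by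
      rw [dist_eq_norm, Subtype.dist_eq, dist_eq_norm]
      exact hM.norm_score_sub_le ϑ ϑ.2 ϑ' ϑ'.2 t ht).continuous
  have hlam : ∀ t ∈ T, Continuous fun ϑ : Θ => lam ϑ t := fun t ht =>
    continuous_iff_continuousAt.2 fun ϑ =>
      (hM.hasGradientAt_lam ϑ.2 ht).continuousAt.comp continuous_subtype_val.continuousAt
  have hae : ∀ {μ : Measure ℝ} {p : ℝ → Prop}, (∀ t ∈ T, p t) → ∀ᵐ t ∂μ.restrict T, p t :=
    fun h => (ae_restrict_iff' hM.measurableSet).2 (.of_forall h)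
  refine Continuous.sub
    (continuous_of_dominated (bound := fun _ => K)
      (fun p => hM.aestronglyMeasurable_score p.1.2)
      (fun p => hae fun t ht => hM.norm_score_le p.1 p.1.2 t ht) (integrable_const K)
      (hae fun t ht => (hscore t ht).comp continuous_fst))
    (continuous_of_dominated (fun p => (hM.integrableOn_lam_smul_score p.2.2 p.1.2).1)
      (fun p => hae fun t ht => hM.norm_lam_smul_score_le p.2.2 p.1.2 ht)
      ((hM.family.integrable ϑ₀ hM.mem).const_mul (K ^ 2))
      (hae fun t ht =>
        ((hlam t ht).comp continuous_snd).smul ((hscore t ht).comp continuous_fst)))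

lemma measurable_scoreStat (hϑ : ϑ ∈ Θ) (ϑ' : EuclideanSpace ℝ (Fin d)) :
    Measurable (scoreStat T lam ϑ ϑ') := by
  have h := measurable_integral_jumpMeasure (hM.measurable_indicator_score hϑ).stronglyMeasurable
  simp only [integral_indicator hM.measurableSet] at h
  exact h.sub_const _

lemma measurable_uncurry_scoreStat :
    Measurable (Function.uncurry fun (p : Θ × Θ) x => scoreStat T lam p.1 p.2 x) :=
  measurable_uncurry_of_continuous_of_measurable hM.continuous_scoreStat
    fun p => hM.measurable_scoreStat p.1.2 p.2

lemma measurable_fisherInvOp : Measurable fun ϑ : Θ => fisherInvOp T lam ϑ :=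
  (LipschitzWith.of_dist_le' fun ϑ ϑ' : Θ => by
    rw [dist_eq_norm, Subtype.dist_eq, dist_eq_norm]
    exact hM.norm_fisherInvOp_sub_le ϑ.2 ϑ'.2).continuous.measurable

lemma measurable_scoreStat_comp {α : Type*} [MeasurableSpace α]
    {a b : α → EuclideanSpace ℝ (Fin d)} {x : α → StieltjesFunction ℝ} (ha : Measurable a)
    (haΘ : ∀ z, a z ∈ Θ) (hb : Measurable b) (hbΘ : ∀ z, b z ∈ Θ) (hx : Measurable x) :
    Measurable fun z => scoreStat T lam (a z) (b z) (x z) :=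
  hM.measurable_uncurry_scoreStat.comp
    (((ha.subtype_mk (h := haΘ)).prodMk (hb.subtype_mk (h := hbΘ))).prodMk hx)

lemma measurable_fisherInvOp_comp {α : Type*} [MeasurableSpace α]
    {a v : α → EuclideanSpace ℝ (Fin d)} (ha : Measurable a) (haΘ : ∀ z, a z ∈ Θ)
    (hv : Measurable v) : Measurable fun z => fisherInvOp T lam (a z) (v z) :=
  ContinuousLinearMap.measurable_apply₂.comp
    ((hM.measurable_fisherInvOp.comp (ha.subtype_mk (h := haΘ))).prodMk hv)

lemma measurable_indicator_fisherInvOp_scoreStat (N k : ℕ) :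
    Measurable ({p : (EuclideanSpace ℝ (Fin d) × EuclideanSpace ℝ (Fin d)) ×
        (ℕ → StieltjesFunction ℝ) | p.1.1 ∈ Θ ∧ p.1.2 ∈ Θ}.indicator fun p =>
      fisherInvOp T lam p.1.1
        ((1 / (k : ℝ)) • ∑ j ∈ Finset.Ico N k, scoreStat T lam p.1.1 p.1.2 (p.2 j))) := by
  have hΘ := hM.isOpen.measurableSet
  refine measurable_indicator_of_subtype
    ((measurable_fst.comp measurable_fst hΘ).inter (measurable_snd.comp measurable_fst hΘ))
    (hM.measurable_fisherInvOp_comp (by fun_prop) (fun p => p.2.1)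
      (Measurable.fun_const_smul (Finset.measurable_fun_sum _ fun j _ =>
        hM.measurable_scoreStat_comp (by fun_prop) (fun p => p.2.1) (by fun_prop) (fun p => p.2.2)
          (by fun_prop)) _))

lemma measurableSet_le_norm_sum_scoreStat_sub (J : Finset ℕ) (r a : ℝ) :
    MeasurableSet {p : EuclideanSpace ℝ (Fin d) × (J → StieltjesFunction ℝ) |
      (p.1 ∈ Θ ∧ ‖p.1 - ϑ₀‖ ≤ r) ∧
        a ≤ ‖∑ j, (scoreStat T lam p.1 ϑ₀ (p.2 j) - scoreStat T lam ϑ₀ ϑ₀ (p.2 j))‖} := by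
  have hΘ : MeasurableSet {p : EuclideanSpace ℝ (Fin d) × (J → StieltjesFunction ℝ) | p.1 ∈ Θ} :=
    measurable_fst hM.isOpen.measurableSet
  have hsum := measurable_indicator_of_subtype hΘ
    (f := fun p => ∑ j, (scoreStat T lam p.1 ϑ₀ (p.2 j) - scoreStat T lam ϑ₀ ϑ₀ (p.2 j)))
    (Finset.measurable_fun_sum _ fun j _ =>
      (hM.measurable_scoreStat_comp (by fun_prop) (fun p => p.2) measurable_const
        (fun _ => hM.mem) (by fun_prop)).sub
      ((hM.measurable_scoreStat hM.mem ϑ₀).comp (by fun_prop)))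
  convert! (hΘ.inter (measurableSet_le (measurable_fst.sub_const ϑ₀).norm
    (measurable_const (a := r)))).inter (measurableSet_le (measurable_const (a := a)) hsum.norm)
    using 1
  ext p
  refine and_congr_right fun hp => ?_
  rw [Set.mem_ofPred_eq, Set.indicator_of_mem (by exact hp.1)]

lemma integral_inner_fisherInvOp_sq (u : EuclideanSpace ℝ (Fin d)) :
    ∫ t, ⟪u, fisherInvOp T lam ϑ₀ (T.indicator (score lam ϑ₀) t)⟫ ^ 2
      ∂(intensityMeasure T (lam ϑ₀)) = u ⬝ᵥ (fisherInfo T lam ϑ₀)⁻¹.mulVec u := by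
  set v := fisherInvOp T lam ϑ₀ u with hv
  have hquad : u ⬝ᵥ (fisherInfo T lam ϑ₀)⁻¹.mulVec u = ⟪v, fisherOp T lam ϑ₀ v⟫ := by
    rw [← Matrix.inner_toEuclideanCLM, hv, hM.fisherOp_fisherInvOp hM.mem, real_inner_comm]
    rfl
  rw [hquad, hM.fisherOp_apply hM.mem, ← integral_inner (hM.integrableOn_inner_smul hM.mem v),
    integral_intensityMeasure hM.measurableSet (hM.family.integrable ϑ₀ hM.mem)
      fun t ht => hM.lam_nonneg hM.mem ht]
  refine setIntegral_congr_fun hM.measurableSet fun t ht => ?_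
  simp only [Set.indicator_of_mem ht, inner_fisherInvOp_comm, ← hv, inner_smul_right, smul_eq_mul,
    real_inner_comm v (score lam ϑ₀ t)]
  ring

end IsBoundedModel

end ScoreStat

section ScoreLimit

variable {d : ℕ} {Θ : Set (EuclideanSpace ℝ (Fin d))} {T : Set ℝ}
  {lam : EuclideanSpace ℝ (Fin d) → ℝ → ℝ} {ϑ ϑ' ϑ₀ : EuclideanSpace ℝ (Fin d)} {K c : ℝ}
  {Ω : Type*} [MeasurableSpace Ω] {P : Measure Ω} {X : ℕ → Ω → StieltjesFunction ℝ}

namespace IsBoundedModel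

section Measurability

variable (hM : IsBoundedModel Θ T lam ϑ₀ K c) (hX : ∀ j, Measurable (X j))
  (hfin : ∀ᵐ ω ∂P, ∀ j, (X j ω).measure Set.univ < ∞)
include hM hX hfin

lemma aemeasurable_scoringCorrection (N k : ℕ) {a b : Ω → EuclideanSpace ℝ (Fin d)}
    (ha : AEMeasurable a P) (hb : AEMeasurable b P) :
    AEMeasurable (fun ω => scoringCorrection Θ T lam N k (fun j => X j ω) (a ω) (b ω)) P := by
  refine ((hM.measurable_indicator_fisherInvOp_scoreStat N k).comp_aemeasurable
    ((ha.prodMk hb).prodMk (measurable_pi_lambda _ hX).aemeasurable)).congr ?_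
  filter_upwards [hfin] with ω hω
  by_cases h : a ω ∈ Θ ∧ b ω ∈ Θ
  · rw [scoringCorrection_eq_fisherInvOp h.1 h.2 hω]
    exact Set.indicator_of_mem (by exact h) _
  · rw [scoringCorrection, if_neg h]
    exact Set.indicator_of_notMem (by exact h) _

lemma aemeasurable_secondPreliminary (N k : ℕ) {a : Ω → EuclideanSpace ℝ (Fin d)}
    (ha : AEMeasurable a P) :
    AEMeasurable (fun ω => secondPreliminary Θ T lam N k (fun j => X j ω) (a ω)) P :=
  ha.add (hM.aemeasurable_scoringCorrection hX hfin N k ha ha)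

lemma aemeasurable_twoStepMLE (N k : ℕ) {a : Ω → EuclideanSpace ℝ (Fin d)}
    (ha : AEMeasurable a P) :
    AEMeasurable (fun ω => twoStepMLE Θ T lam N k (fun j => X j ω) (a ω)) P :=
  have hsecond := hM.aemeasurable_secondPreliminary hX hfin N k ha
  hsecond.add (hM.aemeasurable_scoringCorrection hX hfin N k ha hsecond)

end Measurability

variable [IsProbabilityMeasure P] (hM : IsBoundedModel Θ T lam ϑ₀ K c)
  (hX : ∀ j, IsPoissonPath P (intensityMeasure T (lam ϑ₀)) (X j)) (hind : iIndepFun X P)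
include hM hX hind

lemma measure_le_norm_sum_scoreStat_le (J : Finset ℕ) {a : ℝ} (ha : 0 < a) :
    P {ω | a ≤ ‖∑ j ∈ J, scoreStat T lam ϑ₀ ϑ₀ (X j ω)‖} ≤
      ENNReal.ofReal (J.card * (K ^ 2 * (intensityMeasure T (lam ϑ₀)).real Set.univ) / a ^ 2) := by
  have := hM.isFiniteMeasure_intensityMeasure
  simp only [hM.scoreStat_eq_centeredStat]
  exact IsPoissonPath.measure_le_norm_sum_centeredStat_le hX hind
    (hM.measurable_indicator_score hM.mem).stronglyMeasurable (hM.norm_indicator_score_le hM.mem)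
    J ha

lemma measure_le_norm_sum_scoreStat_sub_le {r : ℝ} (hϑ : ϑ ∈ Θ) (hr : ‖ϑ - ϑ₀‖ ≤ r)
    (J : Finset ℕ) {a : ℝ} (ha : 0 < a) :
    P {ω | a ≤ ‖∑ j ∈ J, (scoreStat T lam ϑ ϑ₀ (X j ω) - scoreStat T lam ϑ₀ ϑ₀ (X j ω))‖} ≤
      ENNReal.ofReal
        (J.card * ((K * r) ^ 2 * (intensityMeasure T (lam ϑ₀)).real Set.univ) / a ^ 2) := by
  have := hM.isFiniteMeasure_intensityMeasure
  simp only [hM.scoreStat_sub_scoreStat_left hϑ hM.mem]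
  exact IsPoissonPath.measure_le_norm_sum_centeredStat_le hX hind
    ((hM.measurable_indicator_score hϑ).sub
      (hM.measurable_indicator_score hM.mem)).stronglyMeasurable
    (fun t => (hM.norm_indicator_score_sub_le hϑ hM.mem t).trans
      (mul_le_mul_of_nonneg_left hr hM.nonneg)) J ha

/- Conditionally on `Y` the sum is a centered statistic of independent observations, so
Chebyshev's inequality applies as it does for a fixed parameter. -/
lemma measure_le_norm_sum_scoreStat_sub_le_of_observed {N : ℕ}
    {Y : Ω → EuclideanSpace ℝ (Fin d)} (hY : Measurable[observedSigma X N] Y) {J : Finset ℕ}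
    (hJ : Disjoint (Finset.range N) J) (r : ℝ) {a : ℝ} (ha : 0 < a) :
    P {ω | (Y ω ∈ Θ ∧ ‖Y ω - ϑ₀‖ ≤ r) ∧ a ≤ ‖∑ j ∈ J,
        (scoreStat T lam (Y ω) ϑ₀ (X j ω) - scoreStat T lam ϑ₀ ϑ₀ (X j ω))‖} ≤
      ENNReal.ofReal
        (J.card * ((K * r) ^ 2 * (intensityMeasure T (lam ϑ₀)).real Set.univ) / a ^ 2) := by
  have hXm := fun j => (hX j).measurable
  have hdecoupled := measure_le_of_indepFun (hY.mono (observedSigma_le hXm N) le_rfl)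
    (measurable_pi_lambda _ fun j : J => hXm j)
    (indepFun_of_measurable_observedSigma hXm hind hY hJ)
    (hM.measurableSet_le_norm_sum_scoreStat_sub J r a) (η := ENNReal.ofReal
      (J.card * ((K * r) ^ 2 * (intensityMeasure T (lam ϑ₀)).real Set.univ) / a ^ 2)) fun y => ?_
  · refine le_trans (measure_mono fun ω hω => ?_) hdecoupled
    refine ⟨hω.1, ?_⟩
    exact hω.2.trans_eq (congrArg norm (Finset.sum_coe_sort J _).symm)
  by_cases hy : y ∈ Θ ∧ ‖y - ϑ₀‖ ≤ r
  · refine (measure_mono fun ω hω => ?_).trans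
      (hM.measure_le_norm_sum_scoreStat_sub_le hX hind hy.1 hy.2 J ha)
    rw [Set.mem_ofPred_eq, ← Finset.sum_coe_sort J]
    exact hω.2
  · simp only [Set.mem_ofPred_eq, hy, false_and, Set.ofPred_false, measure_empty, zero_le]

lemma tendstoInDistribution_sum_fisherInvOp_scoreStat :
    TendstoInDistribution
      (fun (n : ℕ) ω => (√n)⁻¹ • ∑ j ∈ Finset.range n,
        fisherInvOp T lam ϑ₀ (scoreStat T lam ϑ₀ ϑ₀ (X j ω))) atTop id
      (fun _ => P) (multivariateGaussian 0 (fisherInfo T lam ϑ₀)⁻¹) := by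
  have := hM.isFiniteMeasure_intensityMeasure
  simp only [hM.scoreStat_eq_centeredStat, map_centeredStat (fisherInvOp T lam ϑ₀)
    (hM.integrable_indicator_score hM.mem) (hM.integrable_indicator_score hM.mem)]
  exact IsPoissonPath.tendstoInDistribution_sum_centeredStat hX hind
    ((fisherInvOp T lam ϑ₀).measurable.comp
      (hM.measurable_indicator_score hM.mem)).stronglyMeasurable
    (fun t => (fisherInvOp T lam ϑ₀).le_of_opNorm_le_of_le (hM.norm_fisherInvOp_le hM.mem)
      (hM.norm_indicator_score_le hM.mem t))
    (hM.posDef_fisherInfo hM.mem).inv.posSemidef hM.integral_inner_fisherInvOp_sq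

end IsBoundedModel

end ScoreLimit

/-! ### Expansion of the two-step estimate -/

section Expansion

variable {d : ℕ} {Θ : Set (EuclideanSpace ℝ (Fin d))} {T : Set ℝ}
  {lam : EuclideanSpace ℝ (Fin d) → ℝ → ℝ} {ϑ ϑ' ϑ₀ : EuclideanSpace ℝ (Fin d)} {K c M ρ : ℝ}
  {N k : ℕ} {x : ℕ → StieltjesFunction ℝ}

/-- The score statistic `k^{-1/2} ∑_{j ∈ J} ∫_T score(ϑ, t) [dx_j(t) - lam(ϑ₀, t) dt]`, centered
under `ϑ₀` for fixed `ϑ` and of the order of the central limit theorem when `#J ≤ k`. -/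
noncomputable def normalizedScore (T : Set ℝ) (lam : EuclideanSpace ℝ (Fin d) → ℝ → ℝ)
    (ϑ₀ : EuclideanSpace ℝ (Fin d)) (k : ℕ) (J : Finset ℕ) (x : ℕ → StieltjesFunction ℝ)
    (ϑ : EuclideanSpace ℝ (Fin d)) : EuclideanSpace ℝ (Fin d) :=
  (√(k : ℝ))⁻¹ • ∑ j ∈ J, scoreStat T lam ϑ ϑ₀ (x j)

/-- The event on which the two-step estimate is expanded: the first estimate `ϑ` and the normalized
score at `ϑ₀` are of their typical orders, up to a factor `M`, and replacing `ϑ₀` by `ϑ` in the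
score changes the normalized score by at most `ρ`. -/
structure IsTypicalSample (Θ : Set (EuclideanSpace ℝ (Fin d))) (T : Set ℝ)
    (lam : EuclideanSpace ℝ (Fin d) → ℝ → ℝ) (ϑ₀ : EuclideanSpace ℝ (Fin d)) (N k : ℕ) (M ρ : ℝ)
    (x : ℕ → StieltjesFunction ℝ) (ϑ : EuclideanSpace ℝ (Fin d)) : Prop where
  measure_lt_top : ∀ j, (x j).measure Set.univ < ∞
  mem : ϑ ∈ Θ
  norm_sub_le : ‖ϑ - ϑ₀‖ ≤ M * (√(N : ℝ))⁻¹
  norm_normalizedScore_le : ‖normalizedScore T lam ϑ₀ k (Finset.Ico N k) x ϑ₀‖ ≤ M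
  norm_normalizedScore_sub_le : ‖normalizedScore T lam ϑ₀ k (Finset.Ico N k) x ϑ -
    normalizedScore T lam ϑ₀ k (Finset.Ico N k) x ϑ₀‖ ≤ ρ

lemma IsTypicalSample.mono {ρ' : ℝ} (h : IsTypicalSample Θ T lam ϑ₀ N k M ρ x ϑ) (hρ : ρ ≤ ρ') :
    IsTypicalSample Θ T lam ϑ₀ N k M ρ' x ϑ :=
  { h with norm_normalizedScore_sub_le := h.norm_normalizedScore_sub_le.trans hρ }

lemma one_div_smul_sum_scoreStat (k : ℕ) (J : Finset ℕ) (x : ℕ → StieltjesFunction ℝ) :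
    (1 / (k : ℝ)) • ∑ j ∈ J, scoreStat T lam ϑ ϑ₀ (x j) =
      (√(k : ℝ))⁻¹ • normalizedScore T lam ϑ₀ k J x ϑ := by
  rw [normalizedScore, smul_smul, ← mul_inv, Real.mul_self_sqrt (Nat.cast_nonneg k), one_div]

lemma norm_inv_smul_sub_le {E : Type*} [NormedAddCommGroup E] [NormedSpace ℝ E] {p : ℝ}
    (hp : 0 < p) {w U V : E} {B B₀ : E →L[ℝ] E} {a b e : ℝ} (h₁ : ‖w - B (p • U)‖ ≤ a)
    (h₂ : ‖B (U - V)‖ ≤ b) (h₃ : ‖B V - B₀ V‖ ≤ e) : ‖p⁻¹ • w - B₀ V‖ ≤ p⁻¹ * a + b + e := by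
  have hsplit : p⁻¹ • w - B₀ V = p⁻¹ • (w - B (p • U)) + B (U - V) + (B V - B₀ V) := by
    rw [smul_sub, map_smul, inv_smul_smul₀ hp.ne', map_sub]
    abel
  rw [hsplit]
  refine norm_add₃_le.trans (add_le_add (add_le_add ?_ h₂) h₃)
  rw [norm_smul, norm_inv, Real.norm_of_nonneg hp.le]
  gcongr

lemma natCast_div_mul_inv_sqrt_le (hNk : N ≤ k) : (N / k : ℝ) * (√(N : ℝ))⁻¹ ≤ (√(k : ℝ))⁻¹ := by
  rw [div_mul_eq_mul_div, ← div_eq_mul_inv, Real.div_sqrt, ← Real.sqrt_div_self]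
  gcongr

namespace IsBoundedModel

variable (hM : IsBoundedModel Θ T lam ϑ₀ K c)
include hM

lemma add_scoringCorrection_sub_eq (hϑ : ϑ ∈ Θ) (hϑ' : ϑ' ∈ Θ)
    (hx : ∀ j, (x j).measure Set.univ < ∞) (hNk : N ≤ k) (hk : 0 < k) :
    ϑ' + scoringCorrection Θ T lam N k x ϑ ϑ' - ϑ₀ - fisherInvOp T lam ϑ
        ((√(k : ℝ))⁻¹ • normalizedScore T lam ϑ₀ k (Finset.Ico N k) x ϑ) =
      (N / k : ℝ) • (ϑ' - ϑ₀) - (1 - N / k : ℝ) • fisherInvOp T lam ϑ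
        ((∫ t in T, (lam ϑ' t - lam ϑ₀ t) • score lam ϑ t) - fisherOp T lam ϑ (ϑ' - ϑ₀)) := by
  set D := ∫ t in T, (lam ϑ' t - lam ϑ₀ t) • score lam ϑ t
  have hstat : ∀ j, scoreStat T lam ϑ ϑ' (x j) = scoreStat T lam ϑ ϑ₀ (x j) - D := fun j =>
    (sub_eq_of_eq_add' <| sub_eq_iff_eq_add.1 <|
      hM.scoreStat_sub_scoreStat_right hϑ hϑ' (x j)).symm
  have hmean : (1 / (k : ℝ)) • ∑ j ∈ Finset.Ico N k, scoreStat T lam ϑ ϑ' (x j) =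
      (√(k : ℝ))⁻¹ • normalizedScore T lam ϑ₀ k (Finset.Ico N k) x ϑ - (1 - N / k : ℝ) • D := by
    simp only [hstat, Finset.sum_sub_distrib, Finset.sum_const, Nat.card_Ico, smul_sub,
      one_div_smul_sum_scoreStat, ← Nat.cast_smul_eq_nsmul ℝ, smul_smul, Nat.cast_sub hNk,
      one_div_mul_eq_div, sub_div, div_self (Nat.cast_pos (α := ℝ).2 hk).ne']
  rw [scoringCorrection_eq_fisherInvOp hϑ hϑ' hx, hmean, map_sub, map_sub _ D, map_smul _ (1 - _),
    hM.fisherInvOp_fisherOp hϑ]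
  module

/- A scoring correction is a Newton step, so its error is quadratic, apart from the loss due to the
`N` observations left out of an average over `k`. -/
lemma exists_norm_add_scoringCorrection_sub_le :
    ∃ G, 0 ≤ G ∧ ∀ {N k : ℕ} {x : ℕ → StieltjesFunction ℝ} {ϑ ϑ' : EuclideanSpace ℝ (Fin d)},
      ϑ ∈ Θ → ϑ' ∈ Θ → (∀ j, (x j).measure Set.univ < ∞) → N ≤ k → 0 < k →
      ‖ϑ' + scoringCorrection Θ T lam N k x ϑ ϑ' - ϑ₀ - fisherInvOp T lam ϑ
        ((√(k : ℝ))⁻¹ • normalizedScore T lam ϑ₀ k (Finset.Ico N k) x ϑ)‖ ≤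
        ((N / k : ℝ) + G * (‖ϑ - ϑ₀‖ + ‖ϑ' - ϑ‖)) * ‖ϑ' - ϑ₀‖ := by
  have hK := hM.nonneg
  have hL := hM.integral_lam_nonneg
  have hc := hM.pos
  refine ⟨c⁻¹ * ((K ^ 4 + K ^ 3) * ∫ t in T, lam ϑ₀ t), by positivity,
    fun {N k x ϑ ϑ'} hϑ hϑ' hx hNk hk => ?_⟩
  have hfrac : (N / k : ℝ) ≤ 1 :=
    (div_le_one (Nat.cast_pos.2 hk)).2 (Nat.cast_le.2 hNk)
  have hone : ‖(1 - N / k : ℝ)‖ ≤ 1 := by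
    rw [Real.norm_of_nonneg (sub_nonneg.2 hfrac)]
    exact sub_le_self _ (by positivity)
  rw [hM.add_scoringCorrection_sub_eq hϑ hϑ' hx hNk hk, add_mul]
  refine (norm_sub_le _ _).trans (add_le_add ?_ ?_)
  · rw [norm_smul, Real.norm_of_nonneg (by positivity)]
  · rw [norm_smul]
    refine (mul_le_of_le_one_left (norm_nonneg _) hone).trans
      (((fisherInvOp T lam ϑ).le_of_opNorm_le_of_le (hM.norm_fisherInvOp_le hϑ)
        (hM.norm_integral_sub_fisherOp_le hϑ hϑ' hM.mem)).trans_eq ?_)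
    rw [norm_sub_rev ϑ₀ ϑ]
    ring

lemma exists_norm_secondPreliminary_sub_le (hM₀ : 0 ≤ M) :
    ∃ C, ∀ {N k : ℕ} {x : ℕ → StieltjesFunction ℝ} {ϑ : EuclideanSpace ℝ (Fin d)},
      IsTypicalSample Θ T lam ϑ₀ N k M 1 x ϑ → 0 < N → N ≤ k →
      ‖secondPreliminary Θ T lam N k x ϑ - ϑ₀‖ ≤
        C * ((√(k : ℝ))⁻¹ + (√(N : ℝ))⁻¹ ^ 2) := by
  obtain ⟨G, hG, hexp⟩ := hM.exists_norm_add_scoringCorrection_sub_le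
  have hc := hM.pos
  refine ⟨M + G * M ^ 2 + c⁻¹ * (1 + M), fun {N k x ϑ} h hN hNk => ?_⟩
  have hk : 0 < k := hN.trans_le hNk
  set p := (√(k : ℝ))⁻¹
  set q := (√(N : ℝ))⁻¹
  have hp₀ : 0 < p := by positivity
  have hq₀ : 0 < q := by positivity
  have hfrac : (N / k : ℝ) * q ≤ p := natCast_div_mul_inv_sqrt_le hNk
  have hlinear : ‖fisherInvOp T lam ϑ
      (p • normalizedScore T lam ϑ₀ k (Finset.Ico N k) x ϑ)‖ ≤ c⁻¹ * (p * (1 + M)) := by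
    refine (fisherInvOp T lam ϑ).le_of_opNorm_le_of_le (hM.norm_fisherInvOp_le h.mem) ?_
    rw [norm_smul, Real.norm_of_nonneg hp₀.le]
    gcongr
    exact (norm_le_norm_sub_add _ _).trans
      (add_le_add h.norm_normalizedScore_sub_le h.norm_normalizedScore_le)
  calc ‖secondPreliminary Θ T lam N k x ϑ - ϑ₀‖
      ≤ ((N / k : ℝ) + G * (‖ϑ - ϑ₀‖ + ‖ϑ - ϑ‖)) * ‖ϑ - ϑ₀‖ + c⁻¹ * (p * (1 + M)) :=
        (norm_le_norm_sub_add _ _).trans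
          (add_le_add (hexp h.mem h.mem h.measure_lt_top hNk hk) hlinear)
    _ ≤ ((N / k : ℝ) + G * (M * q)) * (M * q) + c⁻¹ * (p * (1 + M)) := by
        rw [sub_self, norm_zero, add_zero]
        gcongr <;> exact h.norm_sub_le
    _ = M * ((N / k : ℝ) * q) + G * M ^ 2 * q ^ 2 + c⁻¹ * (1 + M) * p := by ring
    _ ≤ (M + G * M ^ 2 + c⁻¹ * (1 + M)) * (p + q ^ 2) := by
        have h₁ : M * ((N / k : ℝ) * q) ≤ M * p := by gcongr
        have h₂ : 0 ≤ G * M ^ 2 * p + (M + c⁻¹ * (1 + M)) * q ^ 2 := by positivity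
        linarith

lemma exists_norm_sqrt_smul_twoStepMLE_sub_le :
    ∃ G H, ∀ {N k : ℕ} {M ρ r : ℝ} {x : ℕ → StieltjesFunction ℝ} {ϑ : EuclideanSpace ℝ (Fin d)},
      IsTypicalSample Θ T lam ϑ₀ N k M ρ x ϑ → N ≤ k → 0 < k →
      secondPreliminary Θ T lam N k x ϑ ∈ Θ → ‖secondPreliminary Θ T lam N k x ϑ - ϑ₀‖ ≤ r →
      ‖√(k : ℝ) • (twoStepMLE Θ T lam N k x ϑ - ϑ₀) -
        fisherInvOp T lam ϑ₀ (normalizedScore T lam ϑ₀ k (Finset.Ico N k) x ϑ₀)‖ ≤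
        √(k : ℝ) * (((N / k : ℝ) + G * (2 * M * (√(N : ℝ))⁻¹ + r)) * r) + c⁻¹ * ρ +
          H * M ^ 2 * (√(N : ℝ))⁻¹ := by
  obtain ⟨G, hG, hexp⟩ := hM.exists_norm_add_scoringCorrection_sub_le
  have hK := hM.nonneg
  have hL := hM.integral_lam_nonneg
  have hc := hM.pos
  refine ⟨G, c⁻¹ ^ 2 * ((K ^ 4 + 2 * K ^ 3) * ∫ t in T, lam ϑ₀ t),
    fun {N k M ρ r x ϑ} h hNk hk hmem hr => ?_⟩
  have hp : 0 < (√(k : ℝ))⁻¹ := by positivity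
  have hdist : ‖secondPreliminary Θ T lam N k x ϑ - ϑ‖ ≤ r + M * (√(N : ℝ))⁻¹ :=
    (norm_sub_le_norm_sub_add_norm_sub _ ϑ₀ _).trans
      (add_le_add hr ((norm_sub_rev ϑ₀ ϑ).trans_le h.norm_sub_le))
  have hnewton := hexp h.mem hmem h.measure_lt_top hNk hk
  have hscore := (fisherInvOp T lam ϑ).le_of_opNorm_le_of_le (hM.norm_fisherInvOp_le h.mem)
    h.norm_normalizedScore_sub_le
  have hinv := (fisherInvOp T lam ϑ - fisherInvOp T lam ϑ₀).le_of_opNorm_le_of_le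
    (hM.norm_fisherInvOp_sub_le h.mem hM.mem) h.norm_normalizedScore_le
  rw [sub_apply] at hinv
  have hexpansion := norm_inv_smul_sub_le hp hnewton hscore hinv
  rw [inv_inv] at hexpansion
  refine hexpansion.trans ?_
  have hr₀ : 0 ≤ r := (norm_nonneg _).trans hr
  have hM₀ : 0 ≤ M := (norm_nonneg _).trans h.norm_normalizedScore_le
  gcongr ?_ * ((_ + G * ?_) * ?_) + _ + ?_
  · linarith [h.norm_sub_le]
  · refine (mul_le_mul_of_nonneg_right
      (mul_le_mul_of_nonneg_left h.norm_sub_le (by positivity)) hM₀).trans_eq (by ring)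

end IsBoundedModel

end Expansion

/-! ### Sizes of the learning sample and of the sample -/

section Rates

variable {N k : ℕ → ℕ}

lemma tendsto_inv_sqrt_natCast (hN : Tendsto N atTop atTop) :
    Tendsto (fun n => (√(N n : ℝ))⁻¹) atTop (𝓝 0) :=
  (Real.tendsto_sqrt_atTop.comp (tendsto_natCast_atTop_atTop.comp hN)).inv_tendsto_atTop

lemma eventually_le_of_tendsto_natCast_div (hk : Tendsto k atTop atTop)
    (hNk : Tendsto (fun n => (N n / k n : ℝ)) atTop (𝓝 0)) : ∀ᶠ n in atTop, N n ≤ k n := by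
  filter_upwards [hk.eventually_gt_atTop 0, hNk.eventually_lt_const one_pos] with n hk₀ hlt
  exact_mod_cast ((div_lt_one (Nat.cast_pos.2 hk₀)).1 hlt).le

variable (hN : Tendsto N atTop atTop) (hk : Tendsto k atTop atTop)
  (hNk : Tendsto (fun n => (N n / k n : ℝ)) atTop (𝓝 0))
  (hrate : Tendsto (fun n => √(k n : ℝ) / (N n * √(N n : ℝ))) atTop (𝓝 0))
include hN hk hNk hrate

/- With `σ = √k / (N √N)`, the product of `√k` and the second term of the error is
`1 + √k / N`, and `√k / N` times each term of the first factor is again small. -/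
lemma tendsto_sqrt_mul_expansion_error (G A C : ℝ) :
    Tendsto (fun n => √(k n : ℝ) * (((N n / k n : ℝ) + G * (A * (√(N n : ℝ))⁻¹ +
      C * ((√(k n : ℝ))⁻¹ + (√(N n : ℝ))⁻¹ ^ 2))) *
        (C * ((√(k n : ℝ))⁻¹ + (√(N n : ℝ))⁻¹ ^ 2)))) atTop (𝓝 0) := by
  have hp := tendsto_inv_sqrt_natCast hk
  have hq := tendsto_inv_sqrt_natCast hN
  have hfirst := hNk.add (((hq.const_mul A).add ((hp.add (hq.pow 2)).const_mul C)).const_mul G)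
  have hsecond := hp.add
    (((hrate.const_mul A).add (((hq.pow 2).add (hrate.mul hq)).const_mul C)).const_mul G)
  have hsum := (hfirst.add hsecond).const_mul C
  simp only [ne_eq, OfNat.ofNat_ne_zero, not_false_eq_true, zero_pow, add_zero, mul_zero] at hsum
  refine hsum.congr' ?_
  filter_upwards [hN.eventually_gt_atTop 0, hk.eventually_gt_atTop 0] with n hN₀ hk₀
  have hkn : 0 < √(k n : ℝ) := Real.sqrt_pos.2 (Nat.cast_pos.2 hk₀)
  have hNn : 0 < √(N n : ℝ) := Real.sqrt_pos.2 (Nat.cast_pos.2 hN₀)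
  rw [show (N n / k n : ℝ) = √(N n : ℝ) ^ 2 / √(k n : ℝ) ^ 2 by
      rw [Real.sq_sqrt (Nat.cast_nonneg _), Real.sq_sqrt (Nat.cast_nonneg _)],
    show (N n * √(N n : ℝ) : ℝ) = √(N n : ℝ) ^ 3 by
      rw [pow_succ, Real.sq_sqrt (Nat.cast_nonneg _)]]
  field_simp

end Rates

section FloorRates

variable {δ s : ℝ}

lemma tendsto_natCast_rpow_atTop (hδ : 0 < δ) :
    Tendsto (fun n : ℕ => (n : ℝ) ^ δ) atTop atTop :=
  (tendsto_rpow_atTop hδ).comp tendsto_natCast_atTop_atTop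

lemma tendsto_floor_rpow_div_rpow (hδ : 0 < δ) :
    Tendsto (fun n : ℕ => (⌊(n : ℝ) ^ δ⌋₊ : ℝ) / (n : ℝ) ^ δ) atTop (𝓝 1) :=
  tendsto_nat_floor_div_atTop.comp (tendsto_natCast_rpow_atTop hδ)

lemma tendsto_floor_mul_natCast_div (hs : 0 ≤ s) :
    Tendsto (fun n : ℕ => (⌊s * n⌋₊ : ℝ) / n) atTop (𝓝 s) :=
  (tendsto_nat_floor_mul_div_atTop hs).comp tendsto_natCast_atTop_atTop

lemma tendsto_natCast_rpow_neg {a : ℝ} (ha : 0 < a) :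
    Tendsto (fun n : ℕ => (n : ℝ) ^ (-a)) atTop (𝓝 0) :=
  (tendsto_rpow_neg_atTop ha).comp tendsto_natCast_atTop_atTop

lemma tendsto_floor_rpow_div_floor_mul (hδ₀ : 0 < δ) (hδ₁ : δ < 1) (hs : 0 < s) :
    Tendsto (fun n : ℕ => (⌊(n : ℝ) ^ δ⌋₊ / ⌊s * n⌋₊ : ℝ)) atTop (𝓝 0) := by
  have hlim := ((tendsto_floor_rpow_div_rpow hδ₀).div (tendsto_floor_mul_natCast_div hs.le)
    hs.ne').mul (tendsto_natCast_rpow_neg (sub_pos.2 hδ₁))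
  rw [mul_zero] at hlim
  refine hlim.congr' ?_
  filter_upwards [eventually_gt_atTop 0] with n hn
  have hn₀ : (0 : ℝ) < n := Nat.cast_pos.2 hn
  have hpow : (n : ℝ) ^ (-(1 - δ)) = (n : ℝ) ^ δ / n := by
    rw [neg_sub, Real.rpow_sub_one hn₀.ne']
  rw [Pi.div_apply, hpow]
  field_simp

lemma tendsto_sqrt_floor_mul_div_floor_rpow (hδ : 1 / 3 < δ) (hs : 0 ≤ s) :
    Tendsto (fun n : ℕ => √(⌊s * n⌋₊ : ℝ) / (⌊(n : ℝ) ^ δ⌋₊ * √(⌊(n : ℝ) ^ δ⌋₊ : ℝ))) atTop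
      (𝓝 0) := by
  have hN := tendsto_floor_rpow_div_rpow (δ := δ) (by linarith)
  have hlim := ((tendsto_floor_mul_natCast_div hs).sqrt.div (hN.mul hN.sqrt) (by simp)).mul
    (tendsto_natCast_rpow_neg (a := (3 * δ - 1) / 2) (by linarith))
  rw [mul_zero] at hlim
  refine hlim.congr' ?_
  filter_upwards [eventually_gt_atTop 0] with n hn
  have hn₀ : (0 : ℝ) < n := Nat.cast_pos.2 hn
  have hpow : (n : ℝ) ^ (-((3 * δ - 1) / 2)) = √n / ((n : ℝ) ^ δ * √((n : ℝ) ^ δ)) := by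
    rw [Real.sqrt_eq_rpow, Real.sqrt_eq_rpow, ← Real.rpow_mul hn₀.le, ← Real.rpow_add hn₀,
      ← Real.rpow_sub hn₀]
    congr 1
    ring
  have := Real.sqrt_pos.2 hn₀
  have := Real.sqrt_pos.2 (Real.rpow_pos_of_pos hn₀ δ)
  rw [Pi.div_apply, hpow, Real.sqrt_div (Nat.cast_nonneg _), Real.sqrt_div (Nat.cast_nonneg _)]
  field_simp

end FloorRates

/-! ### Asymptotic linearity in probability -/

section AsymptoticLinearity

variable {d : ℕ} {Θ : Set (EuclideanSpace ℝ (Fin d))} {T : Set ℝ}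
  {lam : EuclideanSpace ℝ (Fin d) → ℝ → ℝ} {ϑ₀ : EuclideanSpace ℝ (Fin d)} {K c : ℝ}
  {N k : ℕ → ℕ}

lemma IsBoundedModel.exists_eventually_expansion (hM : IsBoundedModel Θ T lam ϑ₀ K c)
    (hN : Tendsto N atTop atTop) (hk : Tendsto k atTop atTop)
    (hNk : Tendsto (fun n => (N n / k n : ℝ)) atTop (𝓝 0))
    (hrate : Tendsto (fun n => √(k n : ℝ) / (N n * √(N n : ℝ))) atTop (𝓝 0))
    {M ε : ℝ} (hM₀ : 0 ≤ M) (hε : 0 < ε) :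
    ∃ ρ, 0 < ρ ∧ ∀ᶠ n in atTop, ∀ x ϑ, IsTypicalSample Θ T lam ϑ₀ (N n) (k n) M ρ x ϑ →
      secondPreliminary Θ T lam (N n) (k n) x ϑ ∈ Θ ∧
      ‖√(k n : ℝ) • (twoStepMLE Θ T lam (N n) (k n) x ϑ - ϑ₀) - fisherInvOp T lam ϑ₀
        (normalizedScore T lam ϑ₀ (k n) (Finset.Ico (N n) (k n)) x ϑ₀)‖ < ε := by
  obtain ⟨C, hsecond⟩ := hM.exists_norm_secondPreliminary_sub_le hM₀
  obtain ⟨G, H, htwoStep⟩ := hM.exists_norm_sqrt_smul_twoStepMLE_sub_le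
  have hc := hM.pos
  have hp := tendsto_inv_sqrt_natCast hk
  have hq := tendsto_inv_sqrt_natCast hN
  have herror := tendsto_sqrt_mul_expansion_error hN hk hNk hrate G (2 * M) C
  have hradius := (hp.add (hq.pow 2)).const_mul C
  have hinv := hq.const_mul (H * M ^ 2)
  simp only [ne_eq, OfNat.ofNat_ne_zero, not_false_eq_true, zero_pow, add_zero, mul_zero]
    at hradius hinv
  obtain ⟨R, hR, hball⟩ := Metric.isOpen_iff.1 hM.isOpen ϑ₀ hM.mem
  refine ⟨min 1 (c * (ε / 3)), by positivity, ?_⟩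
  filter_upwards [eventually_le_of_tendsto_natCast_div hk hNk, hN.eventually_gt_atTop 0,
    herror.eventually_lt_const (by positivity : 0 < ε / 3), hradius.eventually_lt_const hR,
    hinv.eventually_lt_const (by positivity : 0 < ε / 3)]
    with n hNkn hN₀ herror_n hradius_n hinv_n x ϑ h
  have hdist := hsecond (h.mono (min_le_left _ _)) hN₀ hNkn
  have hmem : secondPreliminary Θ T lam (N n) (k n) x ϑ ∈ Θ :=
    hball (mem_ball_iff_norm.2 (hdist.trans_lt hradius_n))
  refine ⟨hmem, (htwoStep h hNkn (hN₀.trans_le hNkn) hmem hdist).trans_lt ?_⟩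
  have hscore : c⁻¹ * min 1 (c * (ε / 3)) ≤ ε / 3 :=
    (inv_mul_le_iff₀ hc).2 (min_le_right _ _)
  linarith

lemma tendsto_measure_zero_of_eventually_le_ofReal {Ω : Type*} [MeasurableSpace Ω]
    {P : Measure Ω} {ι : Type*} {l : Filter ι} {A : ι → Set Ω}
    (h : ∀ η : ℝ, 0 < η → ∀ᶠ n in l, P (A n) ≤ ENNReal.ofReal η) :
    Tendsto (fun n => P (A n)) l (𝓝 0) := by
  refine ENNReal.tendsto_nhds_zero.2 fun ε hε => ?_
  have hfin : min ε 1 ≠ ∞ := ((min_le_right ε 1).trans_lt ENNReal.one_lt_top).ne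
  filter_upwards [h (min ε 1).toReal (ENNReal.toReal_pos (lt_min hε one_pos).ne' hfin)] with n hn
  exact (hn.trans_eq (ENNReal.ofReal_toReal hfin)).trans (min_le_left _ _)

variable {Ω : Type*} [MeasurableSpace Ω] {P : Measure Ω} [IsProbabilityMeasure P]
  {X : ℕ → Ω → StieltjesFunction ℝ}

lemma le_norm_inv_sqrt_smul_iff {E : Type*} [NormedAddCommGroup E] [NormedSpace ℝ E] {k : ℕ}
    (hk : 0 < k) (a : ℝ) (v : E) : a ≤ ‖(√(k : ℝ))⁻¹ • v‖ ↔ a * √(k : ℝ) ≤ ‖v‖ := by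
  have hs : 0 < √(k : ℝ) := Real.sqrt_pos.2 (Nat.cast_pos.2 hk)
  rw [norm_smul, norm_inv, Real.norm_of_nonneg hs.le, ← div_eq_inv_mul, le_div_iff₀ hs]

lemma natCast_mul_div_mul_sqrt_sq {k : ℕ} (m : ℕ) (B a : ℝ) :
    m * B / (a * √(k : ℝ)) ^ 2 = (m / k : ℝ) * (B / a ^ 2) := by
  rw [mul_pow, Real.sq_sqrt (Nat.cast_nonneg _), mul_comm (a ^ 2), mul_div_mul_comm]

lemma normalizedScore_sub (k : ℕ) (J : Finset ℕ) (x : ℕ → StieltjesFunction ℝ)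
    (ϑ ϑ' : EuclideanSpace ℝ (Fin d)) :
    normalizedScore T lam ϑ₀ k J x ϑ - normalizedScore T lam ϑ₀ k J x ϑ' =
      (√(k : ℝ))⁻¹ • ∑ j ∈ J, (scoreStat T lam ϑ ϑ₀ (x j) - scoreStat T lam ϑ' ϑ₀ (x j)) := by
  rw [normalizedScore, normalizedScore, ← smul_sub, Finset.sum_sub_distrib]

lemma normalizedScore_range_sub_normalizedScore_Ico {N k : ℕ} (hNk : N ≤ k)
    (x : ℕ → StieltjesFunction ℝ) (ϑ : EuclideanSpace ℝ (Fin d)) :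
    normalizedScore T lam ϑ₀ k (Finset.range k) x ϑ -
      normalizedScore T lam ϑ₀ k (Finset.Ico N k) x ϑ =
      normalizedScore T lam ϑ₀ k (Finset.range N) x ϑ := by
  simp only [normalizedScore, ← smul_sub, ← Finset.sum_range_add_sum_Ico _ hNk,
    add_sub_cancel_right]

namespace IsBoundedModel

variable (hM : IsBoundedModel Θ T lam ϑ₀ K c)
  (hX : ∀ j, IsPoissonPath P (intensityMeasure T (lam ϑ₀)) (X j)) (hind : iIndepFun X P)
include hM

lemma measurable_normalizedScore (hX : ∀ j, Measurable (X j)) (k : ℕ) (J : Finset ℕ) :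
    Measurable fun ω => normalizedScore T lam ϑ₀ k J (fun j => X j ω) ϑ₀ :=
  (Finset.measurable_fun_sum J fun j _ =>
    (hM.measurable_scoreStat hM.mem ϑ₀).comp (hX j)).const_smul (√(k : ℝ))⁻¹

include hX hind

lemma measure_le_norm_normalizedScore_le (J : Finset ℕ) {k : ℕ} (hk : 0 < k) {a : ℝ}
    (ha : 0 < a) :
    P {ω | a ≤ ‖normalizedScore T lam ϑ₀ k J (fun j => X j ω) ϑ₀‖} ≤ ENNReal.ofReal
      ((J.card / k : ℝ) * (K ^ 2 * (intensityMeasure T (lam ϑ₀)).real Set.univ / a ^ 2)) := by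
  simp only [normalizedScore, le_norm_inv_sqrt_smul_iff hk]
  rw [← natCast_mul_div_mul_sqrt_sq]
  exact hM.measure_le_norm_sum_scoreStat_le hX hind J (by positivity)

lemma measure_le_norm_normalizedScore_sub_le_of_observed {N : ℕ}
    {Y : Ω → EuclideanSpace ℝ (Fin d)} (hY : Measurable[observedSigma X N] Y) {J : Finset ℕ}
    (hJ : Disjoint (Finset.range N) J) {k : ℕ} (hk : 0 < k) (r : ℝ) {a : ℝ} (ha : 0 < a) :
    P {ω | (Y ω ∈ Θ ∧ ‖Y ω - ϑ₀‖ ≤ r) ∧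
        a ≤ ‖normalizedScore T lam ϑ₀ k J (fun j => X j ω) (Y ω) -
          normalizedScore T lam ϑ₀ k J (fun j => X j ω) ϑ₀‖} ≤ ENNReal.ofReal
      ((J.card / k : ℝ) *
        ((K * r) ^ 2 * (intensityMeasure T (lam ϑ₀)).real Set.univ / a ^ 2)) := by
  simp only [normalizedScore_sub, le_norm_inv_sqrt_smul_iff hk]
  rw [← natCast_mul_div_mul_sqrt_sq]
  exact hM.measure_le_norm_sum_scoreStat_sub_le_of_observed hX hind hY hJ r (by positivity)

lemma measure_not_isTypicalSample_le {N k : ℕ} (hN : 0 < N) (hk : 0 < k) {M ρ : ℝ} (hM₀ : 0 < M)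
    (hρ : 0 < ρ) (hball : ∀ ϑ, ‖ϑ - ϑ₀‖ ≤ M * (√(N : ℝ))⁻¹ → ϑ ∈ Θ)
    {Y : Ω → EuclideanSpace ℝ (Fin d)} (hY : Measurable[observedSigma X N] Y) :
    P {ω | ¬IsTypicalSample Θ T lam ϑ₀ N k M ρ (fun j => X j ω) (Y ω)} ≤
      P {ω | M < √(N : ℝ) * ‖Y ω - ϑ₀‖} +
      (ENNReal.ofReal (K ^ 2 * (intensityMeasure T (lam ϑ₀)).real Set.univ / M ^ 2) +
        ENNReal.ofReal ((K * (M * (√(N : ℝ))⁻¹)) ^ 2 *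
          (intensityMeasure T (lam ϑ₀)).real Set.univ / ρ ^ 2)) := by
  have := hM.isFiniteMeasure_intensityMeasure
  have hcard : ((Finset.Ico N k).card / k : ℝ) ≤ 1 :=
    (div_le_one (Nat.cast_pos.2 hk)).2 <| Nat.cast_le.2 <|
      (Nat.card_Ico N k).trans_le (Nat.sub_le k N)
  have hdisj : Disjoint (Finset.range N) (Finset.Ico N k) :=
    Finset.range_eq_Ico N ▸ Finset.Ico_disjoint_Ico_consecutive 0 N k
  have hscore := (hM.measure_le_norm_normalizedScore_le hX hind (Finset.Ico N k) hk hM₀).trans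
    (ENNReal.ofReal_le_ofReal (mul_le_of_le_one_left (by positivity) hcard))
  have hincrement := (hM.measure_le_norm_normalizedScore_sub_le_of_observed hX hind hY hdisj hk
    (M * (√(N : ℝ))⁻¹) hρ).trans
      (ENNReal.ofReal_le_ofReal (mul_le_of_le_one_left (by positivity) hcard))
  refine (measure_mono_ae ?_).trans ((measure_union_le _ _).trans (add_le_add le_rfl
    ((measure_union_le _ _).trans (add_le_add hscore hincrement))))
  filter_upwards [ae_all_iff.2 fun j => (hX j).ae_measure_univ_lt_top] with ω hfin hω
  by_contra hcon
  change ω ∉ (_ ∪ (_ ∪ _) : Set Ω) at hcon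
  simp only [Set.mem_union, Set.mem_ofPred_eq, not_or, not_and, not_le, not_lt] at hcon
  obtain ⟨hfirst, hV, hUV⟩ := hcon
  have hY₀ : ‖Y ω - ϑ₀‖ ≤ M * (√(N : ℝ))⁻¹ :=
    (le_mul_inv_iff₀' (Real.sqrt_pos.2 (Nat.cast_pos.2 hN))).2 hfirst
  exact hω ⟨hfin, hball _ hY₀, hY₀, hV.le, (hUV ⟨hball _ hY₀, hY₀⟩).le⟩

variable {Y : ℕ → Ω → EuclideanSpace ℝ (Fin d)} (hY : ∀ n, Measurable[observedSigma X (N n)] (Y n))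
  (htight : ∀ η : ℝ, 0 < η → ∃ M : ℝ, ∀ᶠ n in atTop,
    P {ω | M < √(N n : ℝ) * ‖Y n ω - ϑ₀‖} ≤ ENNReal.ofReal η)
  (hN : Tendsto N atTop atTop) (hk : Tendsto k atTop atTop)
include hY htight hN hk

lemma exists_eventually_measure_not_isTypicalSample_le {η : ℝ} (hη : 0 < η) :
    ∃ M, 0 ≤ M ∧ ∀ ρ, 0 < ρ → ∀ᶠ n in atTop, P {ω | ¬IsTypicalSample Θ T lam ϑ₀ (N n) (k n) M ρ
      (fun j => X j ω) (Y n ω)} ≤ ENNReal.ofReal η := by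
  set L := (intensityMeasure T (lam ϑ₀)).real Set.univ
  have hη₃ : 0 < η / 3 := by positivity
  obtain ⟨M₁, hM₁⟩ := htight (η / 3) hη₃
  have hscore : Tendsto (fun M : ℝ => K ^ 2 * L / M ^ 2) atTop (𝓝 0) :=
    (tendsto_pow_atTop two_ne_zero).const_div_atTop _
  obtain ⟨M, hM₁M, hM₀, hMη⟩ := ((eventually_ge_atTop M₁).and <| (eventually_gt_atTop 0).and <|
    hscore.eventually_le_const hη₃).exists
  refine ⟨M, hM₀.le, fun ρ hρ => ?_⟩
  have hradius := (tendsto_inv_sqrt_natCast hN).const_mul M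
  have hincrement := (((hradius.const_mul K).pow 2).mul_const L).div_const (ρ ^ 2)
  simp only [mul_zero, ne_eq, OfNat.ofNat_ne_zero, not_false_eq_true, zero_pow, zero_mul, zero_div]
    at hradius hincrement
  obtain ⟨R, hR, hball⟩ := Metric.isOpen_iff.1 hM.isOpen ϑ₀ hM.mem
  filter_upwards [hM₁, hN.eventually_gt_atTop 0, hk.eventually_gt_atTop 0,
    hradius.eventually_lt_const hR, hincrement.eventually_le_const hη₃]
    with n hfirst hN₀ hk₀ hradius_n hincrement_n
  refine (hM.measure_not_isTypicalSample_le hX hind hN₀ hk₀ hM₀ hρ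
    (fun ϑ hϑ => hball (mem_ball_iff_norm.2 (hϑ.trans_lt hradius_n))) (hY n)).trans ?_
  calc _ ≤ ENNReal.ofReal (η / 3) + (ENNReal.ofReal (η / 3) + ENNReal.ofReal (η / 3)) := by
        gcongr
        exact (measure_mono fun ω hω => hM₁M.trans_lt hω).trans hfirst
    _ = ENNReal.ofReal η := by
        rw [← ENNReal.ofReal_add hη₃.le hη₃.le, ← ENNReal.ofReal_add hη₃.le (by positivity)]
        congr 1
        ring

variable (hNk : Tendsto (fun n => (N n / k n : ℝ)) atTop (𝓝 0))
  (hrate : Tendsto (fun n => √(k n : ℝ) / (N n * √(N n : ℝ))) atTop (𝓝 0))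
include hNk hrate

lemma tendsto_measure_not_expansion {ε : ℝ} (hε : 0 < ε) :
    Tendsto (fun n => P {ω | ¬((Y n ω ∈ Θ ∧
      secondPreliminary Θ T lam (N n) (k n) (fun j => X j ω) (Y n ω) ∈ Θ) ∧
      ‖√(k n : ℝ) • (twoStepMLE Θ T lam (N n) (k n) (fun j => X j ω) (Y n ω) - ϑ₀) -
        fisherInvOp T lam ϑ₀ (normalizedScore T lam ϑ₀ (k n) (Finset.Ico (N n) (k n))
          (fun j => X j ω) ϑ₀)‖ < ε)}) atTop (𝓝 0) := by
  refine tendsto_measure_zero_of_eventually_le_ofReal fun η hη => ?_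
  obtain ⟨M, hM₀, htypical⟩ :=
    hM.exists_eventually_measure_not_isTypicalSample_le hX hind hY htight hN hk hη
  obtain ⟨ρ, hρ, hexp⟩ := hM.exists_eventually_expansion hN hk hNk hrate hM₀ hε
  filter_upwards [htypical ρ hρ, hexp] with n hle hexp
  refine (measure_mono fun ω => mt fun htyp => ?_).trans hle
  obtain ⟨hmem, hlt⟩ := hexp _ _ htyp
  exact ⟨⟨htyp.mem, hmem⟩, hlt⟩

lemma tendsto_measure_estimates_mem :
    Tendsto (fun n => P {ω | Y n ω ∈ Θ ∧
      secondPreliminary Θ T lam (N n) (k n) (fun j => X j ω) (Y n ω) ∈ Θ}) atTop (𝓝 1) := by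
  have hexp := hM.tendsto_measure_not_expansion hX hind hY htight hN hk hNk hrate one_pos
  have hlim := ENNReal.Tendsto.sub (tendsto_const_nhds (x := (1 : ℝ≥0∞))) hexp
    (Or.inl ENNReal.one_ne_top)
  rw [tsub_zero] at hlim
  refine tendsto_of_tendsto_of_tendsto_of_le_of_le hlim tendsto_const_nhds (fun n => ?_)
    fun n => prob_le_one
  refine tsub_le_iff_right.2 (((measure_univ (μ := P)).ge.trans (measure_mono fun ω _ => ?_)).trans
    (measure_union_le _ _))
  exact (em _).imp And.left id

omit hY htight hN hrate

lemma tendsto_measure_le_norm_normalizedScore_range {ε : ℝ} (hε : 0 < ε) :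
    Tendsto (fun n => P {ω | ε ≤ ‖normalizedScore T lam ϑ₀ (k n) (Finset.range (N n))
      (fun j => X j ω) ϑ₀‖}) atTop (𝓝 0) := by
  have hbound := ENNReal.tendsto_ofReal (hNk.mul_const
    (K ^ 2 * (intensityMeasure T (lam ϑ₀)).real Set.univ / ε ^ 2))
  rw [zero_mul, ENNReal.ofReal_zero] at hbound
  refine tendsto_of_tendsto_of_tendsto_of_le_of_le' tendsto_const_nhds hbound
    (.of_forall fun _ => zero_le) ?_
  filter_upwards [hk.eventually_gt_atTop 0] with n hk₀
  refine (hM.measure_le_norm_normalizedScore_le hX hind (Finset.range (N n)) hk₀ hε).trans_eq ?_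
  rw [Finset.card_range]

/- Only the observations after the first `N` enter the expansion; as `N / k → 0`, the missing ones
do not change the limit law. -/
lemma tendstoInDistribution_normalizedScore_Ico :
    TendstoInDistribution (fun (n : ℕ) ω => fisherInvOp T lam ϑ₀ (normalizedScore T lam ϑ₀ (k n)
        (Finset.Ico (N n) (k n)) (fun j => X j ω) ϑ₀)) atTop id (fun _ => P)
      (multivariateGaussian 0 (fisherInfo T lam ϑ₀)⁻¹) := by
  have hc := hM.pos
  have hclt := hM.tendstoInDistribution_sum_fisherInvOp_scoreStat hX hind
  have hclt_range : TendstoInDistribution (fun (n : ℕ) ω => fisherInvOp T lam ϑ₀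
      (normalizedScore T lam ϑ₀ (k n) (Finset.range (k n)) (fun j => X j ω) ϑ₀)) atTop id
      (fun _ => P) (multivariateGaussian 0 (fisherInfo T lam ϑ₀)⁻¹) := by
    simp only [normalizedScore, map_smul, map_sum]
    exact ⟨fun n => hclt.forall_aemeasurable (k n), hclt.aemeasurable_limit, hclt.tendsto.comp hk⟩
  refine tendstoInDistribution_of_tendstoInMeasure_sub _ _ hclt_range
    (tendstoInMeasure_iff_norm.2 fun ε hε => ?_) fun n => ((fisherInvOp T lam ϑ₀).measurable.comp
      (hM.measurable_normalizedScore (fun j => (hX j).measurable) _ _)).aemeasurable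
  refine tendsto_of_tendsto_of_tendsto_of_le_of_le' tendsto_const_nhds
    (hM.tendsto_measure_le_norm_normalizedScore_range hX hind hk hNk (mul_pos hc hε))
    (.of_forall fun _ => zero_le) ?_
  filter_upwards [eventually_le_of_tendsto_natCast_div hk hNk] with n hNkn
  refine measure_mono fun ω (hω : ε ≤ ‖fisherInvOp T lam ϑ₀ _ - fisherInvOp T lam ϑ₀ _ - 0‖) => ?_
  rw [sub_zero, norm_sub_rev, ← map_sub,
    normalizedScore_range_sub_normalizedScore_Ico hNkn] at hω
  exact (le_inv_mul_iff₀ hc).1 (hω.trans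
    ((fisherInvOp T lam ϑ₀).le_of_opNorm_le (hM.norm_fisherInvOp_le hM.mem) _))

include hY htight hN hrate

lemma tendstoInDistribution_twoStepMLE :
    TendstoInDistribution (fun (n : ℕ) ω =>
        √(k n : ℝ) • (twoStepMLE Θ T lam (N n) (k n) (fun j => X j ω) (Y n ω) - ϑ₀))
      atTop id (fun _ => P) (multivariateGaussian 0 (fisherInfo T lam ϑ₀)⁻¹) := by
  have hXm := fun j => (hX j).measurable
  have hfin := hM.isFiniteMeasure_intensityMeasure
  have hpaths : ∀ᵐ ω ∂P, ∀ j, (X j ω).measure Set.univ < ∞ :=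
    ae_all_iff.2 fun j => (hX j).ae_measure_univ_lt_top
  refine tendstoInDistribution_of_tendstoInMeasure_sub _ _
    (hM.tendstoInDistribution_normalizedScore_Ico hX hind hk hNk) ?_ fun n =>
      AEMeasurable.const_smul ((hM.aemeasurable_twoStepMLE hXm hpaths (N n) (k n)
        ((hY n).mono (observedSigma_le hXm _) le_rfl).aemeasurable).sub_const ϑ₀) √(k n : ℝ)
  refine tendstoInMeasure_iff_norm.2 fun ε hε => ?_
  refine tendsto_of_tendsto_of_tendsto_of_le_of_le tendsto_const_nhds
    (hM.tendsto_measure_not_expansion hX hind hY htight hN hk hNk hrate hε)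
    (fun _ => zero_le) fun n => measure_mono fun ω hω hexp => hexp.2.not_ge ?_
  exact hω.trans_eq (congrArg norm (sub_zero _))

end IsBoundedModel

end AsymptoticLinearity

end

theorem theorem4_general {d : ℕ} {Ω : Type*} [MeasurableSpace Ω] {P : Measure Ω}
    [IsProbabilityMeasure P] {Θ : Set (EuclideanSpace ℝ (Fin d))} (hΘo : IsOpen Θ)
    (hΘc : Convex ℝ Θ) (hΘb : Bornology.IsBounded Θ) {T : Set ℝ} (hT : MeasurableSet T)
    {lam : EuclideanSpace ℝ (Fin d) → ℝ → ℝ} (hlam : IsIntensityFamily Θ T lam)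
    (hreg : IsLipschitzScoreModel Θ T lam) {ϑ₀ : EuclideanSpace ℝ (Fin d)} (hϑ₀ : ϑ₀ ∈ Θ)
    {X : ℕ → Ω → StieltjesFunction ℝ} (hX : ∀ j, IsPoissonProcess P T (lam ϑ₀) (X j))
    (hXindep : iIndepFun (fun (j : ℕ) (ω : Ω) (t : ℝ) => X j ω t) P) {N k : ℕ → ℕ}
    (hN : Tendsto N atTop atTop) (hk : Tendsto k atTop atTop)
    (hNk : Tendsto (fun n => (N n / k n : ℝ)) atTop (𝓝 0))
    (hrate : Tendsto (fun n => √(k n : ℝ) / (N n * √(N n : ℝ))) atTop (𝓝 0))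
    {Y : ℕ → Ω → EuclideanSpace ℝ (Fin d)} (hY : ∀ n, Measurable[observedSigma X (N n)] (Y n))
    (htight : ∀ η : ℝ, 0 < η → ∃ M : ℝ, ∀ᶠ n in atTop,
      P {ω | M < √(N n : ℝ) * ‖Y n ω - ϑ₀‖} ≤ ENNReal.ofReal η) :
    TendstoInDistribution (fun (n : ℕ) ω =>
        √(k n : ℝ) • (twoStepMLE Θ T lam (N n) (k n) (fun j => X j ω) (Y n ω) - ϑ₀))
      atTop id (fun _ => P) (multivariateGaussian 0 (fisherInfo T lam ϑ₀)⁻¹) ∧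
    Tendsto (fun n => P {ω | Y n ω ∈ Θ ∧
      secondPreliminary Θ T lam (N n) (k n) (fun j => X j ω) (Y n ω) ∈ Θ}) atTop (𝓝 1) := by
  obtain ⟨K, c, hM⟩ := hreg.exists_isBoundedModel hlam hΘo hΘc hΘb hT hϑ₀
  have hpath := fun j =>
    (hX j).isPoissonPath hT (hlam.integrable ϑ₀ hϑ₀) fun t ht => (hlam.pos ϑ₀ hϑ₀ t ht).le
  have hind := iIndepFun_of_paths hXindep
  exact ⟨hM.tendstoInDistribution_twoStepMLE hpath hind hY htight hN hk hNk hrate,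
    hM.tendsto_measure_estimates_mem hpath hind hY htight hN hk hNk hrate⟩

theorem theorem4 {d : ℕ} {Ω : Type*} [MeasurableSpace Ω] (P : Measure Ω) [IsProbabilityMeasure P]
    (Θ : Set (EuclideanSpace ℝ (Fin d))) (hΘo : IsOpen Θ) (hΘc : Convex ℝ Θ)
    (hΘb : Bornology.IsBounded Θ)
    (T : Set ℝ) (hT : T.OrdConnected)
    (lam : EuclideanSpace ℝ (Fin d) → ℝ → ℝ) (hlam : IsIntensityFamily Θ T lam)
    (hreg : IsRegularModel Θ T lam)
    (ϑ₀ : EuclideanSpace ℝ (Fin d)) (hϑ₀ : ϑ₀ ∈ Θ)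
    (X : ℕ → Ω → StieltjesFunction ℝ)
    (hX : ∀ j, IsPoissonProcess P T (lam ϑ₀) (X j))
    (hXindep : iIndepFun (fun (j : ℕ) (ω : Ω) (t : ℝ) => X j ω t) P)
    (ϑbar : ℕ → Ω → EuclideanSpace ℝ (Fin d))
    (hprelim : IsPreliminaryEstimator P X ϑbar ϑ₀)
    (δ : ℝ) (hδ : δ ∈ Set.Ioc (1 / 3 : ℝ) (1 / 2)) (s : ℝ) (hs : s ∈ Set.Ioc (0 : ℝ) 1) :
    TendstoInDistribution
      (fun (n : ℕ) (ω : Ω) =>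
        √(⌊s * n⌋₊ : ℝ) •
          (twoStepMLE Θ T lam ⌊(n : ℝ) ^ δ⌋₊ ⌊s * n⌋₊ (fun j => X j ω)
            (ϑbar ⌊(n : ℝ) ^ δ⌋₊ ω) - ϑ₀))
      atTop id (fun _ => P) (multivariateGaussian 0 (fisherInfo T lam ϑ₀)⁻¹) ∧
    Tendsto
      (fun n : ℕ => P {ω | ϑbar ⌊(n : ℝ) ^ δ⌋₊ ω ∈ Θ ∧
        secondPreliminary Θ T lam ⌊(n : ℝ) ^ δ⌋₊ ⌊s * n⌋₊ (fun j => X j ω)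
          (ϑbar ⌊(n : ℝ) ^ δ⌋₊ ω) ∈ Θ})
      atTop (𝓝 1) := by
  have hδ₀ : 0 < δ := by linarith [hδ.1]
  exact theorem4_general hΘo hΘc hΘb hT.measurableSet hlam
    (hreg.isLipschitzScoreModel hΘo hΘc) hϑ₀ hX hXindep
    (tendsto_nat_floor_atTop.comp (tendsto_natCast_rpow_atTop hδ₀))
    (tendsto_nat_floor_atTop.comp (tendsto_natCast_atTop_atTop.const_mul_atTop hs.1))
    (tendsto_floor_rpow_div_floor_mul hδ₀ (by linarith [hδ.2]) hs.1)
    (tendsto_sqrt_floor_mul_div_floor_rpow hδ.1 hs.1.le) (fun _ => hprelim.measurable _)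
    fun η hη => (hprelim.bounded_in_prob η hη).imp fun M hM => .of_forall fun n => hM _
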